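/- **Setting.** Let $G=(V,E)$ be a finite directed graph (parallel edges allowed) drawn in the plane with straight edges of nonzero length and given by adjacency lists; $\delta_v^-,\delta_v^+$ are the in- and out-degree of $v$. (An undirected graph is replaced by the directed graph that contains each edge in both directions.) Every edge $e$ has a real cost $c_e$. The angle cost function $c_a:[0,180]\to S$ is a step function with $|S|$ steps: there are $0=\gamma_0<\gamma_1<\dots<\gamma_{|S|}=180$ and real values $\theta_1,\dots,\theta_{|S|}$ with $c_a(x)=\theta_s$ for $\gamma_{s-1}\le x<\gamma_s$, and $c_a(180)=\theta_{|S|}$. The cost of a walk $e_1,\dots,e_m$ ($m\ge 1$) is $\sum_i c_{e_i}+\sum_{i<m} c_a(\sphericalangle(e_i,e_{i+1}))$, where $\sphericalangle(e,f)\in[0,180]$ is the angle in degrees between the vectors of the edges $e$ and $f$. A shortest walk from $s$ to $t$ is a walk (with at least one edge) of minimum cost. **Update rule.** For a vertex $v$ with incoming edges $e^-_1,\dots,e^-_k$ with current distances $D[e^-_i]\in\mathbb R\cup\{\infty\}$ and outgoing edges $e^+_1,\dots,e^+_l$, let $\alpha_i,\beta_j\in[0,360)$ be the clockwise angles of the edge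 vectors from a fixed direction. If $k=0$ or $l=0$, nothing is done. Otherwise insert the $\beta_j$ in an AVL tree (outgoing edges with equal angle share a node), sort the tuples $(i,s)$, $1\le s\le |S|$, by $D[e^-_i]+\theta_s$, and go through them in increasing order. For the tuple $(i,s)$, retrieve from the tree by range queries, and delete, all $\beta_j$ that agree modulo $360$ with an element of $[\alpha_i+\gamma_{s-1},\alpha_i+\gamma_s)$ or of $(\alpha_i-\gamma_s,\alpha_i-\gamma_{s-1}]$ (both intervals being closed if $s=|S|$), and assign the predecessor $e^-_i$, with value $D[e^-_i]+\theta_s$, to the corresponding outgoing edges. **Minimal-angle Bellman-Ford with $p$ rounds.** Put $D[e]=c_e$ for the edges that leave $s$ and $D[e]=\infty$ for all others. In each of $p$ rounds, go through the vertices; at each vertex apply the update rule and, for each outgoing edge $e^+_j$ with assigned predecessor $e^-_i$ and value $d$, if $d+c_{e^+_j}<D[e^+_j]$, set $D[e^+_j]$ to $d+c_{e^+_j}$ and $P[e^+_j]=e^-_i$. Finally take an incoming edge of $t$ with the smallest finite distance and follow the predecessors $P$ back to $s$ (at most $|E|$ steps); if there is no such edge, report that there is no walk. Time is the number of elementary operations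 of a real RAM (arithmetic on and comparison of reals, evaluation of the angle of a vector, access to array cells, list cells and tree nodes), up to a constant factor. **Theorem.** There is an absolute constant $C$ such that the following holds for all such $G$, edge costs and step functions. 1. For every vertex $v$ with $k=\delta_v^-$ and $l=\delta_v^+$ and all distances $D$, the update rule assigns, if $k\ge 1$, to every outgoing edge $e^+_j$ exactly one predecessor, and it is optimal: the assigned $i$ minimizes $D[e^-_i]+c_a(\sphericalangle(e^-_i,e^+_j))$, and the assigned value is this minimum. It takes at most $C\,(|S|k+l+1)\log(|S|kl+2)$ operations, and at most $C\,(|S|k+l)\log(|S|kl)$ operations if $|S|kl\ge 2$. 2. For all $p\geq 0$ and all $s,t\in V$: if there is a shortest walk from $s$ to $t$ with at most $p+1$ edges, then minimal-angle Bellman-Ford with $p$ rounds and this update rule returns a shortest walk from $s$ to $t$; if there is no walk from $s$ to $t$, it reports so. 3. For $p\ge 1$ its running time is at most $$C\,p\sum_{v\in V}\big(|S|\delta_v^-+\delta_v^++1\big)\log\big(|S|\delta_v^-\delta_v^++2\big),$$ and, if $|S|\delta_v^-\delta_v^+\ge 2$ for all $v$ (in particular, if $1\le|S|<\delta_v^-,\delta_v^+$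 for all $v$), at most $$C\,p\sum_{v\in V}\big(|S|\delta_v^-+\delta_v^+\big)\log\big(|S|\delta_v^-\delta_v^+\big).$$ -/

import Mathlib

/-! Minimal-angle Bellman-Ford with the step-function update rule, in an explicit cost model. -/

namespace MinAngleBF

/-! ## Cost model

An algorithm is a program in the monad `TimeM`, which carries the result and the number of
operations spent so far. The only way to spend is `tick`. The programs below spend at least one
`tick` in each function call, each recursive call and each iteration of a loop, and a `tick` pays
for a bounded number of elementary operations of a real RAM: arithmetic on and comparison of reals
(or `∞`), evaluation of the angle of a vector, one read or write of an array cell, creation or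
inspection of a list cell or of a tree node. -/

/-- A result together with the number of operations that were spent to get it. -/
structure TimeM (α : Type*) where
  ret : α
  time : ℕ

namespace TimeM

instance : Monad TimeM where
  pure a := ⟨a, 0⟩
  bind x f := ⟨(f x.ret).ret, x.time + (f x.ret).time⟩

/-- Spend one operation. -/
def tick : TimeM PUnit := ⟨PUnit.unit, 1⟩

end TimeM

open TimeM

/-! ## Merge sort -/

section Sorting

variable {α : Type} {κ : Type} [LinearOrder κ]

/-- Deal out a list into two halves. -/
def split : List α → TimeM (List α × List α)
  | [] => do
    tick
    pure ([], [])
  | [a] => do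
    tick
    pure ([a], [])
  | a :: b :: l => do
    tick
    let q ← split l
    pure (a :: q.1, b :: q.2)

theorem split_length (l : List α) :
    (split l).ret.1.length ≤ l.length ∧ (split l).ret.2.length ≤ l.length := by
  induction l using split.induct with
  | case1 => exact ⟨le_rfl, le_rfl⟩
  | case2 a => exact ⟨le_rfl, Nat.zero_le _⟩
  | case3 a b l ih =>
    have h1 : (split (a :: b :: l)).ret.1 = a :: (split l).ret.1 := by
      rw [split]; rfl
    have h2 : (split (a :: b :: l)).ret.2 = b :: (split l).ret.2 := by
      rw [split]; rfl
    rw [h1, h2]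
    simp only [List.length_cons]
    omega

/-- Merge two lists that are sorted by `key`. -/
def merge (key : α → κ) : List α → List α → TimeM (List α)
  | [], ys => do
    tick
    pure ys
  | x :: xs, [] => do
    tick
    pure (x :: xs)
  | x :: xs, y :: ys => do
    tick
    if key x ≤ key y then
      let zs ← merge key xs (y :: ys)
      pure (x :: zs)
    else
      let zs ← merge key (x :: xs) ys
      pure (y :: zs)

/-- Merge sort by `key`, smallest key first. The line `let _ ← q` spends the operations of
splitting the list. -/
def mergeSort (key : α → κ) : List α → TimeM (List α)
  | [] => do
    tick
    pure []
  | [a] => do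
    tick
    pure [a]
  | a :: b :: l => do
    tick
    let q := split l
    let _ ← q
    let xs ← mergeSort key (a :: q.ret.1)
    let ys ← mergeSort key (b :: q.ret.2)
    merge key xs ys
  termination_by l => l.length
  decreasing_by
    · have := (split_length l).1
      simp only [List.length_cons]
      omega
    · have := (split_length l).2
      simp only [List.length_cons]
      omega

end Sorting

/-! ## AVL trees -/

/-- Search trees whose nodes store a key, a value and the height. -/
inductive AVL (κ ν : Type) where
  | leaf : AVL κ ν
  | node (l : AVL κ ν) (key : κ) (val : ν) (r : AVL κ ν) (h : ℕ) : AVL κ ν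

namespace AVL

variable {κ ν : Type}

/-- The stored height. -/
def ht : AVL κ ν → ℕ
  | leaf => 0
  | node _ _ _ _ h => h

/-- A node with its height filled in. -/
def mk (l : AVL κ ν) (k : κ) (v : ν) (r : AVL κ ν) : AVL κ ν :=
  node l k v r (max l.ht r.ht + 1)

/-- Join two AVL trees whose heights differ by at most two, with at most two rotations. This is
not recursive: it takes boundedly many operations, paid for by the caller. -/
def balance (l : AVL κ ν) (k : κ) (v : ν) (r : AVL κ ν) : AVL κ ν :=
  if r.ht + 1 < l.ht then
    match l with
    | leaf => mk l k v r
    | node ll lk lv lr _ =>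
      if lr.ht ≤ ll.ht then mk ll lk lv (mk lr k v r)
      else
        match lr with
        | leaf => mk l k v r
        | node lrl lrk lrv lrr _ => mk (mk ll lk lv lrl) lrk lrv (mk lrr k v r)
  else if l.ht + 1 < r.ht then
    match r with
    | leaf => mk l k v r
    | node rl rk rv rr _ =>
      if rl.ht ≤ rr.ht then mk (mk l k v rl) rk rv rr
      else
        match rl with
        | leaf => mk l k v r
        | node rll rlk rlv rlr _ => mk (mk l k v rll) rlk rlv (mk rlr rk rv rr)
  else mk l k v r

variable [LinearOrder κ]

/-- Insert `e` under the key `x`. Several items with the same key share a node, which stores the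
list of them. -/
def insert {ε : Type} (x : κ) (e : ε) : AVL κ (List ε) → TimeM (AVL κ (List ε))
  | leaf => do
    tick
    pure (mk leaf x [e] leaf)
  | node l k v r h => do
    tick
    if x < k then
      let l' ← insert x e l
      pure (balance l' k v r)
    else if k < x then
      let r' ← insert x e r
      pure (balance l k v r')
    else
      pure (node l k (e :: v) r h)

/-- Remove the leftmost entry of the tree with left subtree `l`, root entry `(k, v)` and right
subtree `r`; return that entry and the remaining tree. -/
def popMin : (l : AVL κ ν) → (k : κ) → (v : ν) → (r : AVL κ ν) → TimeM ((κ × ν) × AVL κ ν)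
  | leaf, k, v, r => do
    tick
    pure ((k, v), r)
  | node ll lk lv lr _, k, v, r => do
    tick
    let q ← popMin ll lk lv lr
    pure (q.1, balance q.2 k v r)

/-- Delete the node with key `x`, if there is one. -/
def delete (x : κ) : AVL κ ν → TimeM (AVL κ ν)
  | leaf => do
    tick
    pure leaf
  | node l k v r _ => do
    tick
    if x < k then
      let l' ← delete x l
      pure (balance l' k v r)
    else if k < x then
      let r' ← delete x r
      pure (balance l k v r')
    else
      match r with
      | leaf => pure l
      | node rl rk rv rr _ => do
        let q ← popMin rl rk rv rr
        pure (balance l q.1.1 q.1.2 q.2)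

end AVL

/-- An interval of keys; each end may belong to it or not. -/
structure Range (κ : Type) where
  lo : κ
  hi : κ
  loClosed : Bool
  hiClosed : Bool

namespace Range

variable {κ : Type} [LinearOrder κ]

/-- `x` respects the lower end. -/
def aboveLo (I : Range κ) (x : κ) : Bool := if I.loClosed then I.lo ≤ x else I.lo < x

/-- `x` respects the upper end. -/
def belowHi (I : Range κ) (x : κ) : Bool := if I.hiClosed then x ≤ I.hi else x < I.hi

end Range

/-- `get-inbetween`: add to `acc` all entries of the tree whose key lies in `I`. -/
def getInbetween {κ ν : Type} [LinearOrder κ] (I : Range κ) :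
    AVL κ ν → List (κ × ν) → TimeM (List (κ × ν))
  | AVL.leaf, acc => do
    tick
    pure acc
  | AVL.node l k v r _, acc => do
    tick
    let acc₁ ← if I.aboveLo k then getInbetween I l acc else pure acc
    let acc₂ ← if I.belowHi k then getInbetween I r acc₁ else pure acc₁
    if I.aboveLo k && I.belowHi k then pure ((k, v) :: acc₂) else pure acc₂

/-! ## The step-function update rule -/

/-- `c` is on `[0, 180]` the step function with the `n` values `θ 0, …, θ (n - 1)` and the
breakpoints `0 = γ 0 < γ 1 < ⋯ < γ n = 180`: it is `θ s` on `[γ s, γ (s + 1))`, and the last of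
these intervals contains its right end `180`. -/
structure IsStepFunction {n : ℕ} (c : ℝ → ℝ) (θ : Fin n → ℝ) (γ : Fin (n + 1) → ℝ) : Prop where
  strictMono : StrictMono γ
  first : γ 0 = 0
  last : γ (Fin.last n) = 180
  eq_of_lt : ∀ s x, γ s.castSucc ≤ x → x < γ s.succ → c x = θ s
  eq_last : ∀ s : Fin n, s.succ = Fin.last n → c 180 = θ s

/-- A tuple (incoming edge, index of an angle cost), with the direction of the edge and the
distance value by which the tuples are sorted. -/
structure Candidate (E : Type) (n : ℕ) where
  edge : E
  angle : ℝ
  step : Fin n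
  value : WithTop ℝ

/-- The entry `P[out] = pred`, with the distance value for which `pred` was chosen. -/
structure Assignment (E : Type) where
  out : E
  pred : E
  value : WithTop ℝ

noncomputable section

/-- The directions in `[0, 360)` that enclose with `a` an angle at which the step function takes
its value number `s`: clockwise and anticlockwise from `a`, each with its copy on the other side
of the cut at `0 = 360`. -/
def feasibleRanges {n : ℕ} (γ : Fin (n + 1) → ℝ) (a : ℝ) (s : Fin n) : List (Range ℝ) :=
  let b : Bool := decide (s.succ = Fin.last n)
  [⟨a + γ s.castSucc, a + γ s.succ, true, b⟩,
   ⟨a + γ s.castSucc - 360, a + γ s.succ - 360, true, b⟩,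
   ⟨a - γ s.succ, a - γ s.castSucc, b, true⟩,
   ⟨a - γ s.succ + 360, a - γ s.castSucc + 360, b, true⟩]

section Update

variable {E : Type} {n : ℕ}

/-- Insert the directions of the outgoing edges in an AVL tree. -/
def buildTree (ang : E → ℝ) (outs : List E) : TimeM (AVL ℝ (List E)) :=
  outs.foldlM (fun T e => do
    tick
    AVL.insert (ang e) e T) AVL.leaf

/-- List all tuples (incoming edge, index of an angle cost). -/
def candidates (ang : E → ℝ) (θ : Fin n → ℝ) (D : E → WithTop ℝ) (ins : List E) :
    TimeM (List (Candidate E n)) :=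
  ins.foldlM (fun L i => do
    tick
    let a := ang i
    let d := D i
    (List.finRange n).foldlM (fun L s => do
      tick
      pure (⟨i, a, s, d + (θ s : WithTop ℝ)⟩ :: L)) L) []

/-- Retrieve from the tree all outgoing edges in the range `I`, delete them, and assign to them
the incoming edge of the tuple `τ`. -/
def processRange (τ : Candidate E n) (T : AVL ℝ (List E)) (A : List (Assignment E))
    (I : Range ℝ) : TimeM (AVL ℝ (List E) × List (Assignment E)) := do
  tick
  let R ← getInbetween I T []
  R.foldlM (fun TA q => do
    tick
    let T' ← AVL.delete q.1 TA.1
    let A' ← q.2.foldlM (fun A e => do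
      tick
      pure (⟨e, τ.edge, τ.value⟩ :: A)) TA.2
    pure (T', A')) (T, A)

/-- The main loop over the sorted tuples. -/
def processAll (γ : Fin (n + 1) → ℝ) (L : List (Candidate E n)) (T : AVL ℝ (List E)) :
    TimeM (AVL ℝ (List E) × List (Assignment E)) :=
  L.foldlM (fun TA τ => do
    tick
    (feasibleRanges γ τ.angle τ.step).foldlM
      (fun TA I => processRange τ TA.1 TA.2 I) TA) (T, [])

/-- The step-function update rule at one vertex with incoming edges `ins`, outgoing edges `outs`
and current edge distances `D`, where `ang` gives the direction of an edge in degrees. -/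
def stepUpdate (ang : E → ℝ) (θ : Fin n → ℝ) (γ : Fin (n + 1) → ℝ) (ins outs : List E)
    (D : E → WithTop ℝ) : TimeM (List (Assignment E)) := do
  tick
  if ins.isEmpty || outs.isEmpty then
    pure []
  else
    let T ← buildTree ang outs
    let L ← candidates ang θ D ins
    let L' ← mergeSort Candidate.value L
    let q ← processAll γ L' T
    pure q.2

end Update

/-! ## Graphs in the plane and walks -/

/-- A finite directed graph drawn in the plane with straight edges, given by adjacency lists.
Parallel edges are allowed. -/
structure PlaneDigraph (V E : Type) where
  src : E → V
  tgt : E → V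
  pos : V → ℂ
  pos_ne : ∀ e, pos (src e) ≠ pos (tgt e)
  verts : List V
  verts_nodup : verts.Nodup
  mem_verts : ∀ v, v ∈ verts
  edges : List E
  edges_nodup : edges.Nodup
  mem_edges : ∀ e, e ∈ edges
  ins : V → List E
  ins_nodup : ∀ v, (ins v).Nodup
  mem_ins : ∀ v e, e ∈ ins v ↔ tgt e = v
  outs : V → List E
  outs_nodup : ∀ v, (outs v).Nodup
  mem_outs : ∀ v e, e ∈ outs v ↔ src e = v

namespace PlaneDigraph

variable {V E : Type} (G : PlaneDigraph V E)

/-- The in-degree. -/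
def inDeg (v : V) : ℕ := (G.ins v).length

/-- The out-degree. -/
def outDeg (v : V) : ℕ := (G.outs v).length

/-- The vector of an edge. -/
def vec (e : E) : ℂ := G.pos (G.tgt e) - G.pos (G.src e)

/-- The angle in degrees, between `0` and `180`, by which the direction changes from `e` to `f`. -/
def turn (e f : E) : ℝ := InnerProductGeometry.angle (G.vec e) (G.vec f) * 180 / Real.pi

/-- The direction of an edge: the angle from `w` to its vector in clockwise direction, in degrees,
in `[0, 360)`. -/
def direction (w : ℂ) (e : E) : ℝ :=
  toIcoMod (by norm_num : (0 : ℝ) < 360) 0 (Complex.arg (w / G.vec e) * 180 / Real.pi)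

/-- The list `w` of consecutive edges is a walk (with at least one edge) from `s` to `t`. -/
def IsWalk (s t : V) (w : List E) : Prop :=
  w.IsChain (fun e f => G.tgt e = G.src f) ∧
    w.head?.map G.src = some s ∧ w.getLast?.map G.tgt = some t

/-- The cost of a walk: the costs of its edges and the angle costs between consecutive edges. -/
def walkCost (cost : E → ℝ) (c : ℝ → ℝ) : List E → ℝ
  | [] => 0
  | [e] => cost e
  | e :: f :: w => cost e + c (G.turn e f) + walkCost cost c (f :: w)

/-- `w` is a walk of minimum cost from `s` to `t`. -/
def IsShortestWalk (cost : E → ℝ) (c : ℝ → ℝ) (s t : V) (w : List E) : Prop :=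
  G.IsWalk s t w ∧ ∀ w', G.IsWalk s t w' → G.walkCost cost c w ≤ G.walkCost cost c w'

end PlaneDigraph

/-- The assignments `A` give to each outgoing edge of `v` one incoming edge of `v`, and it is an
optimal predecessor for the edge distances `D`: the sum of its distance and the angle cost is
minimum among the incoming edges. -/
def IsOptimalAssignment {V E : Type} (G : PlaneDigraph V E) (c : ℝ → ℝ) (v : V)
    (D : E → WithTop ℝ) (A : List (Assignment E)) : Prop :=
  (A.map Assignment.out).Nodup ∧
  (G.ins v ≠ [] → ∀ f ∈ G.outs v, ∃ a ∈ A, a.out = f) ∧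
  ∀ a ∈ A, a.out ∈ G.outs v ∧ a.pred ∈ G.ins v ∧
    a.value = D a.pred + (c (G.turn a.pred a.out) : WithTop ℝ) ∧
    ∀ i ∈ G.ins v, a.value ≤ D i + (c (G.turn i a.out) : WithTop ℝ)

/-! ## Minimal-angle Bellman-Ford -/

/-- The edge distances `D` and the predecessors `P`. -/
structure Memory (E : Type) where
  D : E → WithTop ℝ
  P : E → Option E

section BellmanFord

variable {V E : Type} [DecidableEq E] (G : PlaneDigraph V E) {n : ℕ}

/-- Write the distance and the predecessor of one edge. -/
def Memory.write (M : Memory E) (e : E) (d : WithTop ℝ) (q : Option E) : Memory E :=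
  ⟨Function.update M.D e d, Function.update M.P e q⟩

/-- Set `D[e] = ∞` for all edges, then `D[e] = cost e` for the edges that leave `s`. `M` is
arbitrary initial contents of the memory. -/
def initMemory (cost : E → ℝ) (s : V) (M : Memory E) : TimeM (Memory E) := do
  let M' ← G.edges.foldlM (fun M e => do
    tick
    pure (M.write e ⊤ none)) M
  (G.outs s).foldlM (fun M e => do
    tick
    pure (M.write e (cost e : WithTop ℝ) none)) M'

/-- Use the assignments where they improve the distance of an outgoing edge. -/
def relax (cost : E → ℝ) (A : List (Assignment E)) (M : Memory E) : TimeM (Memory E) :=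
  A.foldlM (fun M a => do
    tick
    if a.value + (cost a.out : WithTop ℝ) < M.D a.out then
      pure (M.write a.out (a.value + (cost a.out : WithTop ℝ)) (some a.pred))
    else
      pure M) M

/-- One round: apply the step-function update rule at every vertex. -/
def bfRound (w : ℂ) (cost : E → ℝ) (θ : Fin n → ℝ) (γ : Fin (n + 1) → ℝ) (M : Memory E) :
    TimeM (Memory E) :=
  G.verts.foldlM (fun M v => do
    tick
    let A ← stepUpdate (G.direction w) θ γ (G.ins v) (G.outs v) M.D
    relax cost A M) M

/-- An edge of the list with the smallest finite distance, if there is one. -/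
def bestEdge (D : E → WithTop ℝ) (l : List E) : TimeM (Option E) :=
  l.foldlM (fun b e => do
    tick
    match b with
    | none => pure (if D e < ⊤ then some e else none)
    | some f => pure (if D e < D f then some e else some f)) none

/-- Follow the predecessors from `e`, and put the edges in front of `acc`. The list `fuel` only
counts the steps. -/
def trace (P : E → Option E) : (fuel : List E) → (e : E) → (acc : List E) → TimeM (List E)
  | [], _, acc => do
    tick
    pure acc
  | _ :: fuel, e, acc => do
    tick
    match P e with
    | none => pure (e :: acc)
    | some f => trace P fuel f (e :: acc)

/-- Minimal-angle Bellman-Ford with `p` rounds and the step-function update rule: return a walk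
from `s` to `t`, or `none` if no walk was found. -/
def minAngleBellmanFord (w : ℂ) (cost : E → ℝ) (θ : Fin n → ℝ) (γ : Fin (n + 1) → ℝ)
    (p : ℕ) (s t : V) (M₀ : Memory E) : TimeM (Option (List E)) := do
  tick
  let M₁ ← initMemory G cost s M₀
  let M ← (List.range p).foldlM (fun M _ => do
    tick
    bfRound G w cost θ γ M) M₁
  let b ← bestEdge M.D (G.ins t)
  match b with
  | none => pure none
  | some e => do
    let walk ← trace M.P G.edges e []
    pure (some walk)

end BellmanFord

end

end MinAngleBF

/-!
The update rule is a sweep over the tuples (incoming edge, step of the angle cost function) in the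
order of the values that they offer. Modulo `360`, the directions of two edges differ by their
turning angle up to the sign (`PlaneDigraph.exists_direction_sub_eq`), so the ranges of a tuple
contain only outgoing edges to which the tuple offers the true cost of the turn
(`cost_turn_of_hits`), and for each pair of edges some tuple has the second one in its ranges
(`exists_hits`). While an outgoing edge is in the tree, all tuples that offer it something are still
to come; hence the tuple that removes it makes the best offer (`processAll_spec`).

For the running time, AVL trees have logarithmic height (`AVL.two_pow_ht_le`), and a range query
costs the height plus the size of the output (`getInbetween_time`). The output is deleted, so it is
paid for by a potential that is spread over the entries of the tree; what remains is a logarithmic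
cost for each tuple, and the cost of the merge sort (`stepUpdate_spec`).

In the whole algorithm all changes of the distances are improvements of a single edge by a step
from a predecessor (`Memory.Improves`, `relax_induction`). They preserve that finite distances are
costs of walks, and that each distance is at least what the predecessor offers at present. If the
costs of the walks from `s` to `t` are bounded below, they also preserve that the predecessors form
no cycle from which `t` can be reached, because an improvement that closes such a cycle would give
a closed walk of negative cost (`Memory.Acyclic.improves`). So following the predecessors ends in
an edge that leaves `s`, and gives a walk that costs at most the distance of its last edge
(`trace_spec`). After `p` rounds this distance is at most the cost of each walk with at most
`p + 1` edges (`rounds_D_le`).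
-/

namespace MinAngleBF

open TimeM

/-! ### Results and running times of programs -/

namespace TimeM

variable {α β : Type*}

@[simp] theorem ret_pure (a : α) : (pure a : TimeM α).ret = a := rfl

@[simp] theorem time_pure (a : α) : (pure a : TimeM α).time = 0 := rfl

@[simp] theorem ret_bind {α β : Type _} (x : TimeM α) (f : α → TimeM β) :
    (x >>= f).ret = (f x.ret).ret := rfl

@[simp] theorem time_bind {α β : Type _} (x : TimeM α) (f : α → TimeM β) :
    (x >>= f).time = x.time + (f x.ret).time := rfl

@[simp] theorem ret_map {α β : Type _} (f : α → β) (x : TimeM α) : (f <$> x).ret = f x.ret := rfl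

@[simp] theorem time_map {α β : Type _} (f : α → β) (x : TimeM α) : (f <$> x).time = x.time := rfl

@[simp] theorem time_tick : tick.time = 1 := rfl

instance : LawfulMonad TimeM := LawfulMonad.mk'
  (id_map := fun _ => rfl)
  (pure_bind := fun a f => by simp [bind, pure])
  (bind_assoc := fun x f g => by simp [bind, Nat.add_assoc])

/-- Amortized analysis of a loop: if each iteration preserves the invariant `inv` and spends at
most `K x` operations plus the decrease of the potential `Φ`, the loop spends at most the sum of
the `K x` plus the decrease of `Φ`. -/
theorem foldlM_amortized {α β : Type _} (f : β → α → TimeM β) (inv : β → Prop) (Φ : β → ℕ)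
    (K : α → ℕ) (l : List α) (b : β) (hb : inv b)
    (h : ∀ b, ∀ x ∈ l, inv b →
      inv (f b x).ret ∧ (f b x).time + Φ (f b x).ret ≤ Φ b + K x) :
    inv (l.foldlM f b).ret ∧
      (l.foldlM f b).time + Φ (l.foldlM f b).ret ≤ Φ b + (l.map K).sum := by
  induction l generalizing b with
  | nil => simpa using hb
  | cons x l ih =>
    obtain ⟨h1, h2⟩ := h b x (by simp) hb
    obtain ⟨h3, h4⟩ := ih (f b x).ret h1 (fun b y hy => h b y (by simp [hy]))
    simp only [List.foldlM_cons, ret_bind, time_bind, List.map_cons, List.sum_cons]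
    exact ⟨h3, by omega⟩

theorem foldlM_ret_induction {α β : Type _} (f : β → α → TimeM β) (inv : β → Prop) (l : List α)
    (b : β) (hb : inv b) (h : ∀ b, ∀ x ∈ l, inv b → inv (f b x).ret) :
    inv (l.foldlM f b).ret := by
  induction l generalizing b with
  | nil => simpa using hb
  | cons x l ih =>
    exact ih (f b x).ret (h b x (by simp) hb) (fun b y hy => h b y (by simp [hy]))

theorem foldlM_time_le {α β : Type _} (f : β → α → TimeM β) (inv : β → Prop) (K : ℕ)
    (l : List α) (b : β) (hb : inv b)
    (h : ∀ b, ∀ x ∈ l, inv b → inv (f b x).ret ∧ (f b x).time ≤ K) :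
    (l.foldlM f b).time ≤ l.length * K := by
  have := (foldlM_amortized f inv (fun _ => 0) (fun _ => K) l b hb
    (fun b x hx hb => by simpa using h b x hx hb)).2
  simpa using this

end TimeM

/-! ### Merge sort -/

section Sorting

variable {α : Type} {κ : Type} [LinearOrder κ]

theorem split_spec (l : List α) :
    ((split l).ret.1 ++ (split l).ret.2).Perm l ∧
      (split l).ret.1.length ≤ (l.length + 1) / 2 ∧ (split l).ret.2.length ≤ l.length / 2 ∧
      (split l).time ≤ l.length + 1 := by
  induction l using split.induct with
  | case1 => simp [split]
  | case2 a => simp [split]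
  | case3 a b l ih =>
    obtain ⟨h1, h2, h3, h4⟩ := ih
    simp only [split, ret_bind, time_bind, ret_pure, time_pure, time_tick, List.length_cons]
    refine ⟨?_, by omega, by omega, by omega⟩
    exact (List.perm_middle.trans (h1.cons b)).cons a

theorem merge_spec (key : α → κ) (xs ys : List α)
    (hx : xs.Pairwise (fun a b => key a ≤ key b)) (hy : ys.Pairwise (fun a b => key a ≤ key b)) :
    (merge key xs ys).ret.Perm (xs ++ ys) ∧
      (merge key xs ys).ret.Pairwise (fun a b => key a ≤ key b) ∧
      (merge key xs ys).time ≤ xs.length + ys.length + 1 := by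
  induction xs, ys using merge.induct with
  | case1 ys => simpa [merge] using hy
  | case2 x xs => simpa [merge] using hx
  | case3 x xs y ys ih1 ih2 =>
    obtain ⟨hx1, -⟩ := List.pairwise_cons.1 hx
    obtain ⟨hy1, -⟩ := List.pairwise_cons.1 hy
    by_cases hxy : key x ≤ key y
    · obtain ⟨h1, h2, h3⟩ := ih1 hx.of_cons hy
      simp only [merge, if_pos hxy, ret_bind, time_bind, ret_pure, time_pure, time_tick,
        List.length_cons] at *
      refine ⟨h1.cons x, List.pairwise_cons.2 ⟨fun z hz => ?_, h2⟩, by omega⟩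
      rcases List.mem_append.1 (h1.subset hz) with hz | hz
      · exact hx1 z hz
      · rcases List.mem_cons.1 hz with rfl | hz
        · exact hxy
        · exact hxy.trans (hy1 z hz)
    · obtain ⟨h1, h2, h3⟩ := ih2 hx hy.of_cons
      simp only [merge, if_neg hxy, ret_bind, time_bind, ret_pure, time_pure, time_tick,
        List.length_cons] at *
      refine ⟨(h1.cons y).trans List.perm_middle.symm, List.pairwise_cons.2 ⟨fun z hz => ?_, h2⟩,
        by omega⟩
      have hyx := (not_le.1 hxy).le
      rcases List.mem_append.1 (h1.subset hz) with hz | hz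
      · rcases List.mem_cons.1 hz with rfl | hz
        · exact hyx
        · exact hyx.trans (hx1 z hz)
      · exact hy1 z hz

theorem mergeSort_spec (key : α → κ) (l : List α) :
    (mergeSort key l).ret.Perm l ∧
      (mergeSort key l).ret.Pairwise (fun a b => key a ≤ key b) := by
  induction l using mergeSort.induct with
  | case1 => simp [mergeSort]
  | case2 a => simp [mergeSort]
  | case3 a b l ih1 ih2 =>
    obtain ⟨h1, h2, -⟩ := merge_spec key _ _ ih1.2 ih2.2
    rw [mergeSort]
    simp only [ret_bind]
    refine ⟨h1.trans ((ih1.1.append ih2.1).trans ?_), h2⟩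
    exact (List.perm_middle.trans ((split_spec l).1.cons b)).cons a

/-- On `m ≤ 2 ^ d` elements the recursion has depth at most `d`, and each level costs at most
`3 * m`. -/
theorem mergeSort_time (key : α → κ) (l : List α) (d : ℕ) (hl : l.length ≤ 2 ^ d) :
    (mergeSort key l).time ≤ 3 * l.length * d + 2 * l.length + 1 := by
  suffices H : l ≠ [] → (mergeSort key l).time ≤ 3 * l.length * d + 2 * l.length by
    by_cases h : l = []
    · subst h; simp [mergeSort]
    · exact (H h).trans (Nat.le_succ _)
  induction l using mergeSort.induct generalizing d with
  | case1 => simp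
  | case2 a => simp [mergeSort]
  | case3 a b l ih1 ih2 =>
    intro _
    obtain ⟨hp, hs1, hs2, hs3⟩ := split_spec l
    have hlen := hp.length_eq
    rw [List.length_append] at hlen
    obtain ⟨m1, m2⟩ := mergeSort_spec key (a :: (split l).ret.1)
    obtain ⟨m3, m4⟩ := mergeSort_spec key (b :: (split l).ret.2)
    have m5 := (merge_spec key _ _ m2 m4).2.2
    rw [m1.length_eq, m3.length_eq] at m5
    cases d with
    | zero => simp at hl
    | succ d =>
      simp only [List.length_cons, pow_succ] at hl m5
      have t1 := ih1 d (by simp only [List.length_cons]; omega) (by simp)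
      have t2 := ih2 d (by simp only [List.length_cons]; omega) (by simp)
      simp only [List.length_cons] at t1 t2
      rw [mergeSort]
      simp only [time_bind, time_tick, List.length_cons, ← hlen] at *
      nlinarith

end Sorting

/-! ### AVL trees -/

namespace AVL

variable {κ ν : Type}

/-- The entries of a tree in inorder. -/
def toList : AVL κ ν → List (κ × ν)
  | leaf => []
  | node l k v r _ => l.toList ++ (k, v) :: r.toList

@[simp] theorem ht_leaf : (leaf : AVL κ ν).ht = 0 := rfl

@[simp] theorem ht_node (l : AVL κ ν) (k : κ) (v : ν) (r : AVL κ ν) (h : ℕ) :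
    (node l k v r h).ht = h := rfl

/-- The AVL invariant: the stored heights are correct, and the heights of two siblings differ by at
most one. -/
def Bal : AVL κ ν → Prop
  | leaf => True
  | node l _ _ r h => Bal l ∧ Bal r ∧ h = max l.ht r.ht + 1 ∧ l.ht ≤ r.ht + 1 ∧ r.ht ≤ l.ht + 1

/-- The keys increase strictly in inorder: `T` is a search tree. -/
def Sorted [LinearOrder κ] (T : AVL κ ν) : Prop := T.toList.Pairwise (fun p q => p.1 < q.1)

theorem toList_balance (l : AVL κ ν) (k : κ) (v : ν) (r : AVL κ ν) :
    (balance l k v r).toList = l.toList ++ (k, v) :: r.toList := by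
  unfold balance
  split_ifs
  · cases l with
    | leaf => simp [mk, toList]
    | node ll lk lv lr _ =>
      dsimp only
      split_ifs
      · simp [mk, toList]
      · cases lr <;> simp [mk, toList]
  · cases r with
    | leaf => simp [mk, toList]
    | node rl rk rv rr _ =>
      dsimp only
      split_ifs
      · simp [mk, toList]
      · cases rl <;> simp [mk, toList]
  · simp [mk, toList]

theorem balance_spec {l r : AVL κ ν} (k : κ) (v : ν) (hl : l.Bal) (hr : r.Bal)
    (h1 : l.ht ≤ r.ht + 2) (h2 : r.ht ≤ l.ht + 2) :
    (balance l k v r).Bal ∧ max l.ht r.ht ≤ (balance l k v r).ht ∧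
      (balance l k v r).ht ≤ max l.ht r.ht + 1 ∧
      (l.ht ≤ r.ht + 1 → r.ht ≤ l.ht + 1 → (balance l k v r).ht = max l.ht r.ht + 1) := by
  unfold balance
  split_ifs with c1 c2
  · cases l with
    | leaf => simp at c1
    | node ll lk lv lr _ =>
      dsimp only
      split_ifs with c3
      · simp only [Bal, mk, ht_node] at *
        grind
      · cases lr with
        | leaf => simp at c3
        | node =>
          simp only [Bal, mk, ht_node] at *
          grind
  · cases r with
    | leaf => simp at c2
    | node rl rk rv rr _ =>
      dsimp only
      split_ifs with c3
      · simp only [Bal, mk, ht_node] at *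
        grind
      · cases rl with
        | leaf => simp at c3
        | node =>
          simp only [Bal, mk, ht_node] at *
          grind
  · simp only [Bal, mk, ht_node] at *
    grind

/-- A tree of height `h` has at least `2 ^ (h / 2) - 1` nodes. -/
theorem two_pow_ht_le (T : AVL κ ν) (hT : T.Bal) : 2 ^ (T.ht / 2) ≤ T.toList.length + 1 := by
  induction T with
  | leaf => simp [toList]
  | node l k v r h ihl ihr =>
    obtain ⟨bl, br, rfl, h1, h2⟩ := hT
    have ihl := ihl bl
    have ihr := ihr br
    simp only [ht_node, toList, List.length_append, List.length_cons]
    rcases Nat.lt_or_ge (max l.ht r.ht) 1 with h | h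
    · have : (max l.ht r.ht + 1) / 2 = 0 := by omega
      rw [this]; omega
    · -- both subtrees have height at least `max l.ht r.ht - 1`
      obtain ⟨m, hm⟩ := Nat.exists_eq_add_of_le' h
      have e : (max l.ht r.ht + 1) / 2 = m / 2 + 1 := by omega
      have e1 : 2 ^ (m / 2) ≤ 2 ^ (l.ht / 2) := Nat.pow_le_pow_right (by omega) (by omega)
      have e2 : 2 ^ (m / 2) ≤ 2 ^ (r.ht / 2) := Nat.pow_le_pow_right (by omega) (by omega)
      rw [e, pow_succ]; omega

theorem popMin_spec (l : AVL κ ν) (k : κ) (v : ν) (r : AVL κ ν) :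
    (popMin l k v r).ret.1 :: (popMin l k v r).ret.2.toList = l.toList ++ (k, v) :: r.toList := by
  induction l generalizing k v r with
  | leaf => simp [popMin, toList]
  | node ll lk lv lr h ihl ihr =>
    rw [popMin]
    simp only [ret_bind, ret_pure, toList_balance, toList]
    rw [← List.cons_append, ihl]

theorem popMin_bal (l : AVL κ ν) (k : κ) (v : ν) (r : AVL κ ν) (h : ℕ)
    (hb : (node l k v r h).Bal) :
    (popMin l k v r).ret.2.Bal ∧ h ≤ (popMin l k v r).ret.2.ht + 1 ∧
      (popMin l k v r).ret.2.ht ≤ h ∧ (popMin l k v r).time ≤ h := by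
  induction l generalizing k v r h with
  | leaf =>
    obtain ⟨bl, br, rfl, h1, h2⟩ := hb
    simp only [popMin, ret_bind, time_bind, ret_pure, time_pure, time_tick, ht_leaf] at *
    exact ⟨br, by omega, by omega, by omega⟩
  | node ll lk lv lr hl ihl ihr =>
    obtain ⟨bl, br, rfl, h1, h2⟩ := hb
    obtain ⟨i1, i2, i3, i4⟩ := ihl lk lv lr hl bl
    simp only [ht_node] at h1 h2
    have := balance_spec k v i1 br (by omega) (by omega)
    rw [popMin]
    simp only [ret_bind, time_bind, ret_pure, time_pure, time_tick, ht_node] at *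
    refine ⟨this.1, ?_, ?_, ?_⟩ <;> omega

/-- All items in the nodes of the tree. -/
def items {ε : Type} (T : AVL κ (List ε)) : List ε := T.toList.flatMap Prod.snd

theorem mem_items {ε : Type} {T : AVL κ (List ε)} {e : ε} :
    e ∈ T.items ↔ ∃ q ∈ T.toList, e ∈ q.2 := by
  simp [items, List.mem_flatMap]

variable [LinearOrder κ]

theorem sorted_node {l r : AVL κ ν} {k : κ} {v : ν} {h : ℕ} :
    (node l k v r h).Sorted ↔ l.Sorted ∧ r.Sorted ∧ (∀ q ∈ l.toList, q.1 < k) ∧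
      ∀ q ∈ r.toList, k < q.1 := by
  simp only [Sorted, toList, List.pairwise_append, List.pairwise_cons, List.mem_cons,
    forall_eq_or_imp]
  constructor
  · rintro ⟨h1, ⟨h2, h3⟩, h4⟩
    exact ⟨h1, h3, fun q hq => (h4 q hq).1, h2⟩
  · rintro ⟨h1, h2, h3, h4⟩
    exact ⟨h1, ⟨h4, h2⟩, fun q hq => ⟨h3 q hq, fun q' hq' => (h3 q hq).trans (h4 q' hq')⟩⟩

section Insert

variable {ε : Type}

theorem insert_bal (x : κ) (e : ε) (T : AVL κ (List ε)) (hT : T.Bal) :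
    (insert x e T).ret.Bal ∧ T.ht ≤ (insert x e T).ret.ht ∧
      (insert x e T).ret.ht ≤ T.ht + 1 ∧ (insert x e T).time ≤ T.ht + 1 := by
  induction T with
  | leaf => simp [insert, Bal, mk, ht_node]
  | node l k v r h ihl ihr =>
    obtain ⟨bl, br, rfl, h1, h2⟩ := hT
    rw [insert]
    split_ifs with c1 c2
    · obtain ⟨i1, i2, i3, i4⟩ := ihl bl
      have := balance_spec k v i1 br (by omega) (by omega)
      simp only [ret_bind, time_bind, ret_pure, time_pure, time_tick, ht_node]
      refine ⟨this.1, ?_, ?_, ?_⟩ <;> omega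
    · obtain ⟨i1, i2, i3, i4⟩ := ihr br
      have := balance_spec k v bl i1 (by omega) (by omega)
      simp only [ret_bind, time_bind, ret_pure, time_pure, time_tick, ht_node]
      refine ⟨this.1, ?_, ?_, ?_⟩ <;> omega
    · simp only [ret_bind, time_bind, ret_pure, time_pure, time_tick, ht_node]
      exact ⟨⟨bl, br, rfl, h1, h2⟩, by omega, by omega, by omega⟩

theorem insert_spec (ang : ε → κ) (e : ε) (T : AVL κ (List ε)) (hT : T.Sorted)
    (ha : ∀ q ∈ T.toList, ∀ f ∈ q.2, ang f = q.1) :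
    (∀ q ∈ (insert (ang e) e T).ret.toList, q.1 = ang e ∨ ∃ q' ∈ T.toList, q'.1 = q.1) ∧
      (insert (ang e) e T).ret.Sorted ∧
      (∀ q ∈ (insert (ang e) e T).ret.toList, ∀ f ∈ q.2, ang f = q.1) ∧
      (insert (ang e) e T).ret.items.Perm (e :: T.items) ∧
      (insert (ang e) e T).ret.toList.length ≤ T.toList.length + 1 := by
  induction T with
  | leaf => simp [insert, Sorted, mk, toList, items]
  | node l k v r h ihl ihr =>
    obtain ⟨sl, sr, hl, hr⟩ := sorted_node.1 hT
    have hal : ∀ q ∈ l.toList, ∀ f ∈ q.2, ang f = q.1 := fun q hq => ha q (by simp [toList, hq])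
    have har : ∀ q ∈ r.toList, ∀ f ∈ q.2, ang f = q.1 := fun q hq => ha q (by simp [toList, hq])
    have hav : ∀ f ∈ v, ang f = k := ha (k, v) (by simp [toList])
    rw [insert]
    split_ifs with c1 c2
    · obtain ⟨i1, i2, i3, i4, i5⟩ := ihl sl hal
      simp only [ret_bind, ret_pure, toList_balance]
      refine ⟨?_, ?_, ?_, ?_, ?_⟩
      · intro q hq
        simp only [toList, List.mem_append, List.mem_cons] at hq ⊢
        grind
      · have : (node (insert (ang e) e l).ret k v r h).Sorted := by
          refine sorted_node.2 ⟨i2, sr, fun q hq => ?_, hr⟩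
          grind
        simpa only [Sorted, toList, toList_balance] using this
      · intro q hq
        simp only [List.mem_append, List.mem_cons] at hq
        grind
      · simpa [items, toList, toList_balance] using i4.append_right _
      · simp only [toList, List.length_append, List.length_cons]; omega
    · obtain ⟨i1, i2, i3, i4, i5⟩ := ihr sr har
      simp only [ret_bind, ret_pure, toList_balance]
      refine ⟨?_, ?_, ?_, ?_, ?_⟩
      · intro q hq
        simp only [toList, List.mem_append, List.mem_cons] at hq ⊢
        grind
      · have : (node l k v (insert (ang e) e r).ret h).Sorted := by
          refine sorted_node.2 ⟨sl, i2, hl, fun q hq => ?_⟩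
          grind
        simpa only [Sorted, toList, toList_balance] using this
      · intro q hq
        simp only [List.mem_append, List.mem_cons] at hq
        grind
      · have := (i4.append_left (l.items ++ v)).trans List.perm_middle
        simpa [items, toList, toList_balance] using this
      · simp only [toList, List.length_append, List.length_cons]; omega
    · have hk : ang e = k := le_antisymm (not_lt.1 c2) (not_lt.1 c1)
      simp only [ret_bind, ret_pure]
      refine ⟨?_, sorted_node.2 ⟨sl, sr, hl, hr⟩, ?_, ?_, by simp [toList]⟩
      · intro q hq
        simp only [toList, List.mem_append, List.mem_cons] at hq ⊢
        grind
      · intro q hq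
        simp only [toList, List.mem_append, List.mem_cons] at hq
        grind
      · simp [items, toList]

end Insert

theorem delete_bal (x : κ) (T : AVL κ ν) (hT : T.Bal) :
    (delete x T).ret.Bal ∧ T.ht ≤ (delete x T).ret.ht + 1 ∧ (delete x T).ret.ht ≤ T.ht ∧
      (delete x T).time ≤ T.ht + 1 := by
  induction T with
  | leaf => simp [delete, Bal]
  | node l k v r h ihl ihr =>
    obtain ⟨bl, br, rfl, h1, h2⟩ := hT
    simp only [delete]
    split_ifs with c1 c2
    · obtain ⟨i1, i2, i3, i4⟩ := ihl bl
      have := balance_spec k v i1 br (by omega) (by omega)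
      simp only [ret_bind, time_bind, ret_pure, time_pure, time_tick, ht_node]
      refine ⟨this.1, ?_, ?_, ?_⟩ <;> omega
    · obtain ⟨i1, i2, i3, i4⟩ := ihr br
      have := balance_spec k v bl i1 (by omega) (by omega)
      simp only [ret_bind, time_bind, ret_pure, time_pure, time_tick, ht_node]
      refine ⟨this.1, ?_, ?_, ?_⟩ <;> omega
    · cases r with
      | leaf =>
        simp only [ret_bind, time_bind, ret_pure, time_pure, time_tick, ht_leaf, ht_node] at *
        exact ⟨bl, by omega, by omega, by omega⟩
      | node rl rk rv rr hr =>
        obtain ⟨i1, i2, i3, i4⟩ := popMin_bal rl rk rv rr hr br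
        simp only [ht_node] at h1 h2
        have := balance_spec (popMin rl rk rv rr).ret.1.1 (popMin rl rk rv rr).ret.1.2 bl i1
          (by omega) (by omega)
        simp only [ret_bind, time_bind, ret_pure, time_pure, time_tick, ht_node]
        refine ⟨this.1, ?_, ?_, ?_⟩ <;> omega

theorem toList_delete (x : κ) (T : AVL κ ν) (hT : T.Sorted) :
    (delete x T).ret.toList = T.toList.filter (fun q => q.1 ≠ x) := by
  induction T with
  | leaf => simp [delete, toList]
  | node l k v r h ihl ihr =>
    obtain ⟨sl, sr, hl, hr⟩ := sorted_node.1 hT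
    have keepl : k ≤ x → l.toList.filter (fun q => decide (q.1 ≠ x)) = l.toList := fun hk =>
      List.filter_eq_self.2 fun q hq => decide_eq_true ((hl q hq).trans_le hk).ne
    have keepr : x ≤ k → r.toList.filter (fun q => decide (q.1 ≠ x)) = r.toList := fun hk =>
      List.filter_eq_self.2 fun q hq => decide_eq_true (hk.trans_lt (hr q hq)).ne'
    rw [toList, List.filter_append, List.filter_cons]
    rcases lt_trichotomy x k with c | rfl | c
    · rw [keepr c.le]
      simp [delete, c, c.ne', toList_balance, ihl sl]
    · rw [keepl le_rfl, keepr le_rfl]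
      cases r with
      | leaf => simp [delete, toList]
      | node rl rk rv rr hr =>
        simp only [delete, lt_irrefl, if_false, ret_bind, toList]
        rw [← popMin_spec]
        simp [toList_balance]
    · rw [keepl c.le]
      simp [delete, c, c.ne, c.not_gt, toList_balance, ihr sr]

end AVL

/-! ### Range queries -/

namespace Range

variable {κ : Type} [LinearOrder κ]

/-- `x` lies in the interval. -/
def mem (I : Range κ) (x : κ) : Bool := I.aboveLo x && I.belowHi x

theorem aboveLo_mono {I : Range κ} {x y : κ} (h : x ≤ y) (hx : I.aboveLo x) : I.aboveLo y := by
  unfold aboveLo at *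
  split_ifs at * <;> simp only [decide_eq_true_eq] at * <;> order

theorem belowHi_anti {I : Range κ} {x y : κ} (h : x ≤ y) (hy : I.belowHi y) : I.belowHi x := by
  unfold belowHi at *
  split_ifs at * <;> simp only [decide_eq_true_eq] at * <;> order

end Range

section RangeQuery

variable {κ ν : Type} [LinearOrder κ]

open AVL

theorem getInbetween_perm (I : Range κ) (T : AVL κ ν) (hT : T.Sorted) (acc : List (κ × ν)) :
    (getInbetween I T acc).ret.Perm (T.toList.filter (fun q => I.mem q.1) ++ acc) := by
  induction T generalizing acc with
  | leaf => simp [getInbetween, toList]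
  | node l k v r h ihl ihr =>
    obtain ⟨sl, sr, hl, hr⟩ := sorted_node.1 hT
    have dropl : ¬ I.aboveLo k → l.toList.filter (fun q => I.mem q.1) = [] := fun hk =>
      List.filter_eq_nil_iff.2 fun q hq h =>
        hk (Range.aboveLo_mono (hl q hq).le (Bool.and_eq_true_iff.1 h).1)
    have dropr : ¬ I.belowHi k → r.toList.filter (fun q => I.mem q.1) = [] := fun hk =>
      List.filter_eq_nil_iff.2 fun q hq h =>
        hk (Range.belowHi_anti (hr q hq).le (Bool.and_eq_true_iff.1 h).2)
    rw [getInbetween, toList, List.filter_append, List.filter_cons]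
    by_cases c1 : I.aboveLo k <;> by_cases c2 : I.belowHi k
    · have hl := ihl sl acc
      have hr := ihr sr (getInbetween I l acc).ret
      have hm : I.mem k = true := by simp [Range.mem, c1, c2]
      simp only [c1, c2, hm, ret_bind, ret_pure, if_true, Bool.and_self, List.append_assoc]
      refine ((hr.trans (hl.append_left _)).cons (k, v)).trans ?_
      rw [← List.append_assoc, ← List.append_assoc, ← List.cons_append]
      exact (((List.perm_append_comm).cons _).trans List.perm_middle.symm).append_right _
    · have hl := ihl sl acc
      have hm : I.mem k = false := by simp [Range.mem, c2]
      simpa [c1, c2, hm, dropr c2] using hl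
    · have hr := ihr sr acc
      have hm : I.mem k = false := by simp [Range.mem, c1]
      simpa [c1, c2, hm, dropl c1] using hr
    · have hm : I.mem k = false := by simp [Range.mem, c1]
      simp [c1, c2, hm, dropl c1, dropr c2]

/-- A range query that retrieves the whole tree visits every node and every leaf. -/
theorem getInbetween_time_all (I : Range κ) (T : AVL κ ν) (acc : List (κ × ν))
    (hI : ∀ q ∈ T.toList, I.mem q.1) :
    (getInbetween I T acc).time ≤ 2 * T.toList.length + 1 := by
  induction T generalizing acc with
  | leaf => simp [getInbetween]
  | node l k v r h ihl ihr =>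
    have hk := Bool.and_eq_true_iff.1 (hI (k, v) (by simp [toList]))
    have hl := ihl acc (fun q hq => hI q (by simp [toList, hq]))
    have hr := ihr (getInbetween I l acc).ret (fun q hq => hI q (by simp [toList, hq]))
    rw [getInbetween]
    simp only [hk.1, hk.2, time_bind, time_pure, time_tick, if_true, Bool.and_self,
      toList, List.length_append, List.length_cons]
    omega

/-- If the upper end of the interval does not matter, the query continues at the right child of a
node outside the interval; at a node inside, the right subtree is retrieved completely, which is
paid for by the output. So apart from the output only one path is followed. -/
theorem getInbetween_time_of_belowHi (I : Range κ) (T : AVL κ ν) (hT : T.Sorted) (hb : T.Bal)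
    (acc : List (κ × ν)) (hI : ∀ q ∈ T.toList, I.belowHi q.1) :
    (getInbetween I T acc).time ≤
      2 * (T.toList.filter (fun q => I.mem q.1)).length + T.ht + 1 := by
  induction T generalizing acc with
  | leaf => simp [getInbetween]
  | node l k v r h ihl ihr =>
    obtain ⟨sl, sr, -, hr⟩ := sorted_node.1 hT
    obtain ⟨bl, br, rfl, -, -⟩ := hb
    have hk := hI (k, v) (by simp [toList])
    rw [getInbetween, toList, List.filter_append, List.filter_cons]
    by_cases c : I.aboveLo k
    · have tl := ihl sl bl acc (fun q hq => hI q (by simp [toList, hq]))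
      have hr' : ∀ q ∈ r.toList, I.mem q.1 := fun q hq => Bool.and_eq_true_iff.2
        ⟨Range.aboveLo_mono (hr q hq).le c, hI q (by simp [toList, hq])⟩
      have tr := getInbetween_time_all I r (getInbetween I l acc).ret hr'
      have hm : I.mem k = true := by simp [Range.mem, c, hk]
      simp only [c, hk, hm, time_bind, time_pure, time_tick, if_true, Bool.and_self,
        List.length_append, List.length_cons, List.filter_eq_self.2 hr', ht_node]
      omega
    · have tr := ihr sr br acc (fun q hq => hI q (by simp [toList, hq]))
      have hm : I.mem k = false := by simp [Range.mem, c]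
      simp only [c, hk, hm, time_bind, time_pure, time_tick, if_true, Bool.false_and,
        List.length_append, ht_node, ret_pure, Bool.false_eq_true, if_false]
      omega

theorem getInbetween_time_of_aboveLo (I : Range κ) (T : AVL κ ν) (hT : T.Sorted) (hb : T.Bal)
    (acc : List (κ × ν)) (hI : ∀ q ∈ T.toList, I.aboveLo q.1) :
    (getInbetween I T acc).time ≤
      2 * (T.toList.filter (fun q => I.mem q.1)).length + T.ht + 1 := by
  induction T generalizing acc with
  | leaf => simp [getInbetween]
  | node l k v r h ihl ihr =>
    obtain ⟨sl, sr, hl, -⟩ := sorted_node.1 hT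
    obtain ⟨bl, br, rfl, -, -⟩ := hb
    have hk := hI (k, v) (by simp [toList])
    rw [getInbetween, toList, List.filter_append, List.filter_cons]
    by_cases c : I.belowHi k
    · have hl' : ∀ q ∈ l.toList, I.mem q.1 := fun q hq => Bool.and_eq_true_iff.2
        ⟨hI q (by simp [toList, hq]), Range.belowHi_anti (hl q hq).le c⟩
      have tl := getInbetween_time_all I l acc hl'
      have tr := ihr sr br (getInbetween I l acc).ret (fun q hq => hI q (by simp [toList, hq]))
      have hm : I.mem k = true := by simp [Range.mem, c, hk]
      simp only [c, hk, hm, time_bind, time_pure, time_tick, if_true, Bool.and_self,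
        List.length_append, List.length_cons, List.filter_eq_self.2 hl', ht_node]
      omega
    · have tl := ihl sl bl acc (fun q hq => hI q (by simp [toList, hq]))
      have hm : I.mem k = false := by simp [Range.mem, c]
      simp only [c, hk, hm, time_bind, time_pure, time_tick, if_true, Bool.and_false,
        List.length_append, ht_node, ret_pure, Bool.false_eq_true, if_false]
      omega

/-- A range query takes time linear in the height of the tree and in the size of the output. -/
theorem getInbetween_time (I : Range κ) (T : AVL κ ν) (hT : T.Sorted) (hb : T.Bal)
    (acc : List (κ × ν)) :
    (getInbetween I T acc).time ≤
      2 * (T.toList.filter (fun q => I.mem q.1)).length + 2 * T.ht + 1 := by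
  induction T generalizing acc with
  | leaf => simp [getInbetween]
  | node l k v r h ihl ihr =>
    obtain ⟨sl, sr, hl, hr⟩ := sorted_node.1 hT
    obtain ⟨bl, br, rfl, -, -⟩ := hb
    rw [getInbetween, toList, List.filter_append, List.filter_cons]
    by_cases c1 : I.aboveLo k <;> by_cases c2 : I.belowHi k
    · have tl := getInbetween_time_of_belowHi I l sl bl acc
        (fun q hq => Range.belowHi_anti (hl q hq).le c2)
      have tr := getInbetween_time_of_aboveLo I r sr br (getInbetween I l acc).ret
        (fun q hq => Range.aboveLo_mono (hr q hq).le c1)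
      have hm : I.mem k = true := by simp [Range.mem, c1, c2]
      simp only [c1, c2, hm, time_bind, time_pure, time_tick, if_true, Bool.and_self,
        List.length_append, List.length_cons, ht_node]
      omega
    · have tl := ihl sl bl acc
      have hm : I.mem k = false := by simp [Range.mem, c2]
      simp only [c1, c2, hm, time_bind, time_pure, time_tick, if_true, Bool.and_false,
        List.length_append, ht_node, ret_pure, Bool.false_eq_true, if_false]
      omega
    · have tr := ihr sr br acc
      have hm : I.mem k = false := by simp [Range.mem, c1]
      simp only [c1, c2, hm, time_bind, time_pure, time_tick, if_true, Bool.false_and,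
        List.length_append, ht_node, ret_pure, Bool.false_eq_true, if_false]
      omega
    · simp only [c1, c2, time_bind, time_pure, time_tick, Bool.false_and,
        ret_pure, Bool.false_eq_true, if_false]
      omega

end RangeQuery

/-! ### Directions, turning angles and feasible ranges -/

namespace PlaneDigraph

variable {V E : Type} (G : PlaneDigraph V E)

theorem vec_ne_zero (e : E) : G.vec e ≠ 0 := sub_ne_zero.2 (G.pos_ne e).symm

theorem turn_nonneg (e f : E) : 0 ≤ G.turn e f :=
  div_nonneg (mul_nonneg (InnerProductGeometry.angle_nonneg _ _) (by norm_num)) Real.pi_pos.le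

theorem turn_le (e f : E) : G.turn e f ≤ 180 := by
  rw [turn, div_le_iff₀ Real.pi_pos]
  nlinarith [InnerProductGeometry.angle_le_pi (G.vec e) (G.vec f)]

theorem direction_mem (w : ℂ) (e : E) : 0 ≤ G.direction w e ∧ G.direction w e < 360 := by
  have := toIcoMod_mem_Ico (by norm_num : (0 : ℝ) < 360) 0
    (Complex.arg (w / G.vec e) * 180 / Real.pi)
  simpa [direction] using this

/-- Modulo `360`, the directions of two edges differ by their turning angle, up to the sign. -/
theorem exists_direction_sub_eq {w : ℂ} (hw : w ≠ 0) (e f : E) :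
    ∃ (A : ℝ) (m : ℤ), G.direction w f - G.direction w e = A + 360 * m ∧ |A| = G.turn e f := by
  have he := G.vec_ne_zero e
  have hf := G.vec_ne_zero f
  have hprod : w / G.vec f = w / G.vec e * (G.vec e / G.vec f) := by field_simp
  have harg := Complex.arg_mul_coe_angle (div_ne_zero hw he) (div_ne_zero he hf)
  rw [← hprod, ← Real.Angle.coe_add, Real.Angle.angle_eq_iff_two_pi_dvd_sub] at harg
  obtain ⟨k, hk⟩ := harg
  have hpi := Real.pi_pos
  refine ⟨(G.vec e / G.vec f).arg * 180 / Real.pi,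
    k + toIcoDiv (by norm_num : (0 : ℝ) < 360) 0 (Complex.arg (w / G.vec e) * 180 / Real.pi) -
      toIcoDiv (by norm_num : (0 : ℝ) < 360) 0 (Complex.arg (w / G.vec f) * 180 / Real.pi),
    ?_, ?_⟩
  · rw [direction, direction, toIcoMod, toIcoMod]
    have : (w / G.vec f).arg =
        (w / G.vec e).arg + (G.vec e / G.vec f).arg + 2 * Real.pi * k := by linarith
    rw [this]
    push_cast
    simp only [zsmul_eq_mul]
    field_simp
    ring
  · rw [turn, Complex.angle_eq_abs_arg he hf, abs_div, abs_mul, abs_of_pos hpi]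
    norm_num

end PlaneDigraph

theorem abs_eq_of_eq_add {A u : ℝ} {m : ℤ} (hA : |A| ≤ 180) (h0 : 0 ≤ u) (h1 : u ≤ 180)
    (h : u = A + 360 * m) : |A| = u := by
  obtain ⟨hA1, hA2⟩ := abs_le.1 hA
  have m0 : -1 < m := by exact_mod_cast (by linarith : (-1 : ℝ) < m)
  have m1 : m < 2 := by exact_mod_cast (by linarith : (m : ℝ) < 2)
  obtain rfl | rfl : m = 0 ∨ m = 1 := by omega
  · push_cast at h
    rw [abs_of_nonneg] <;> linarith
  · push_cast at h
    rw [abs_of_nonpos] <;> linarith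

section Ranges

variable {n : ℕ} {c : ℝ → ℝ} {θ : Fin n → ℝ} {γ : Fin (n + 1) → ℝ}

/-- The direction `x` lies in one of the ranges that belong to the direction `a` and the step `s`
of the angle cost function. -/
def Hits (γ : Fin (n + 1) → ℝ) (a : ℝ) (s : Fin n) (x : ℝ) : Prop :=
  ∃ I ∈ feasibleRanges γ a s, I.mem x

namespace IsStepFunction

theorem nonneg (h : IsStepFunction c θ γ) (j : Fin (n + 1)) : 0 ≤ γ j :=
  h.first ▸ h.strictMono.monotone (Fin.zero_le j)

theorem le_last (h : IsStepFunction c θ γ) (j : Fin (n + 1)) : γ j ≤ 180 :=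
  h.last ▸ h.strictMono.monotone (Fin.le_last j)

theorem pos (h : IsStepFunction c θ γ) : 1 ≤ n := by
  rcases Nat.eq_zero_or_pos n with rfl | hn
  · have h0 := h.first
    have h1 := h.last
    simp only [Fin.last_zero, Fin.isValue] at h1
    linarith
  · exact hn

theorem exists_step (h : IsStepFunction c θ γ) {x : ℝ} (h0 : 0 ≤ x) :
    ∃ s : Fin n, γ s.castSucc ≤ x ∧ (x < γ s.succ ∨ s.succ = Fin.last n) := by
  by_contra! H
  have key : ∀ j, γ j ≤ x := fun j => by
    induction j using Fin.induction with
    | zero => rwa [h.first]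
    | succ s ih => exact (H s ih).1
  obtain ⟨k, rfl⟩ := Nat.exists_eq_add_of_le' h.pos
  exact (H (Fin.last k) (key _)).2 (Fin.succ_last k)

end IsStepFunction

variable {V E : Type} (G : PlaneDigraph V E)

theorem cost_turn_of_hits (h : IsStepFunction c θ γ) {w : ℂ} (hw : w ≠ 0) {e f : E} {s : Fin n}
    (hs : Hits γ (G.direction w e) s (G.direction w f)) : c (G.turn e f) = θ s := by
  obtain ⟨A, m, hA, ht⟩ := G.exists_direction_sub_eq hw e f
  have hA' : |A| ≤ 180 := ht ▸ G.turn_le e f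
  have g0 := h.nonneg s.castSucc
  have g1 := h.le_last s.succ
  obtain ⟨h1, h2⟩ : γ s.castSucc ≤ |A| ∧
      (|A| < γ s.succ ∨ s.succ = Fin.last n ∧ |A| ≤ γ s.succ) := by
    obtain ⟨I, hI, hx⟩ := hs
    simp only [feasibleRanges, List.mem_cons, List.not_mem_nil, or_false] at hI
    rw [Range.mem, Range.aboveLo, Range.belowHi] at hx
    by_cases hb : s.succ = Fin.last n <;> rcases hI with rfl | rfl | rfl | rfl <;>
      simp only [hb, decide_true, decide_false, if_true, Bool.false_eq_true, if_false,
        Bool.and_eq_true, decide_eq_true_eq] at hx g1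
    · rw [abs_eq_of_eq_add (u := G.direction w f - G.direction w e) (m := m) hA'
        (by linarith) (by linarith) (by linarith)]
      exact ⟨by linarith, Or.inr ⟨hb, by rw [hb]; linarith⟩⟩
    · rw [abs_eq_of_eq_add (u := G.direction w f - G.direction w e + 360) (m := m + 1) hA'
        (by linarith) (by linarith) (by push_cast; linarith)]
      exact ⟨by linarith, Or.inr ⟨hb, by rw [hb]; linarith⟩⟩
    · rw [← abs_neg, abs_eq_of_eq_add (A := -A) (u := G.direction w e - G.direction w f) (m := -m)
        (by rwa [abs_neg]) (by linarith) (by linarith) (by push_cast; linarith)]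
      exact ⟨by linarith, Or.inr ⟨hb, by rw [hb]; linarith⟩⟩
    · rw [← abs_neg, abs_eq_of_eq_add (A := -A) (u := G.direction w e - G.direction w f + 360)
        (m := -m + 1) (by rwa [abs_neg]) (by linarith) (by linarith) (by push_cast; linarith)]
      exact ⟨by linarith, Or.inr ⟨hb, by rw [hb]; linarith⟩⟩
    · rw [abs_eq_of_eq_add (u := G.direction w f - G.direction w e) (m := m) hA'
        (by linarith) (by linarith) (by linarith)]
      exact ⟨by linarith, Or.inl (by linarith)⟩
    · rw [abs_eq_of_eq_add (u := G.direction w f - G.direction w e + 360) (m := m + 1) hA'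
        (by linarith) (by linarith) (by push_cast; linarith)]
      exact ⟨by linarith, Or.inl (by linarith)⟩
    · rw [← abs_neg, abs_eq_of_eq_add (A := -A) (u := G.direction w e - G.direction w f) (m := -m)
        (by rwa [abs_neg]) (by linarith) (by linarith) (by push_cast; linarith)]
      exact ⟨by linarith, Or.inl (by linarith)⟩
    · rw [← abs_neg, abs_eq_of_eq_add (A := -A) (u := G.direction w e - G.direction w f + 360)
        (m := -m + 1) (by rwa [abs_neg]) (by linarith) (by linarith) (by push_cast; linarith)]
      exact ⟨by linarith, Or.inl (by linarith)⟩
  rw [← ht]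
  rcases h2 with h2 | ⟨hs, h2⟩
  · exact h.eq_of_lt s _ h1 h2
  · rcases h2.lt_or_eq with h2 | h2
    · exact h.eq_of_lt s _ h1 h2
    · rw [h2, hs, h.last]
      exact h.eq_last s hs

theorem exists_hits (h : IsStepFunction c θ γ) {w : ℂ} (hw : w ≠ 0) (e f : E) :
    ∃ s : Fin n, Hits γ (G.direction w e) s (G.direction w f) := by
  obtain ⟨A, m, hA, ht⟩ := G.exists_direction_sub_eq hw e f
  obtain ⟨s, h1, h2⟩ := h.exists_step (G.turn_nonneg e f)
  have hA' := ht ▸ G.turn_le e f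
  have h3 : s.succ = Fin.last n → G.turn e f ≤ γ s.succ := fun hs => by
    rw [hs, h.last]; exact G.turn_le e f
  obtain ⟨e0, e1⟩ := G.direction_mem w e
  obtain ⟨f0, f1⟩ := G.direction_mem w f
  obtain ⟨hA1, hA2⟩ := abs_le.1 hA'
  have m0 : -2 < m := by exact_mod_cast (by linarith : (-2 : ℝ) < m)
  have m1 : m < 2 := by exact_mod_cast (by linarith : (m : ℝ) < 2)
  refine ⟨s, ?_⟩
  simp only [Hits, feasibleRanges, List.mem_cons, List.not_mem_nil, or_false,
    exists_eq_or_imp, exists_eq_left, Range.mem, Range.aboveLo, Range.belowHi, if_true]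
  rw [← ht] at h1 h2 h3
  rcases abs_cases A with ⟨hA, h0⟩ | ⟨hA, h0⟩ <;> rw [hA] at h1 h2 h3 <;>
    by_cases hb : s.succ = Fin.last n <;>
    simp only [hb, decide_true, decide_false, if_true, Bool.false_eq_true, if_false,
        Bool.and_eq_true, decide_eq_true_eq, or_false, forall_const, or_true] at h2 h3 ⊢ <;>
    obtain rfl | rfl | rfl : m = -1 ∨ m = 0 ∨ m = 1 := by omega
  all_goals push_cast at *
  all_goals first
    | (exfalso; linarith)
    | (left; constructor <;> linarith)
    | (right; left; constructor <;> linarith)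
    | (right; right; left; constructor <;> linarith)
    | (right; right; right; constructor <;> linarith)

end Ranges

/-! ### The tree of outgoing edges -/

section Update

open AVL

variable {E : Type} {n : ℕ}

/-- `T` is an AVL tree of height at most `H` that stores edges under their directions. -/
structure IsEdgeTree (ang : E → ℝ) (H : ℕ) (T : AVL ℝ (List E)) : Prop where
  sorted : T.Sorted
  bal : T.Bal
  ht_le : T.ht ≤ H
  ang_eq : ∀ q ∈ T.toList, ∀ f ∈ q.2, ang f = q.1

/-- The potential of a list of entries of a tree of height at most `H`: it pays for the retrieval
and the deletion of these entries and for the assignments to their edges. -/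
def potential (H : ℕ) (l : List (ℝ × List E)) : ℕ := (l.map fun q => H + 4 + q.2.length).sum

theorem potential_append (H : ℕ) (l l' : List (ℝ × List E)) :
    potential H (l ++ l') = potential H l + potential H l' := by
  simp [potential]

theorem potential_perm (H : ℕ) {l l' : List (ℝ × List E)} (h : l.Perm l') :
    potential H l = potential H l' := (h.map _).sum_eq

theorem potential_eq (H : ℕ) (l : List (ℝ × List E)) :
    potential H l = l.length * (H + 4) + (l.flatMap Prod.snd).length := by
  induction l with
  | nil => simp [potential]
  | cons q l ih =>
    simp only [potential, List.map_cons, List.sum_cons, List.length_cons, List.flatMap_cons,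
      List.length_append] at ih ⊢
    rw [ih]; ring

theorem AVL.ht_le_log (T : AVL ℝ (List E)) (hT : T.Bal) {N : ℕ} (hN : T.toList.length ≤ N) :
    T.ht ≤ 2 * Nat.log 2 (N + 1) + 1 := by
  have h1 := two_pow_ht_le T hT
  have h2 : T.ht / 2 ≤ Nat.log 2 (N + 1) :=
    Nat.le_log_of_pow_le (by norm_num) (h1.trans (by omega))
  omega

theorem buildTree_spec (ang : E → ℝ) (outs : List E) :
    let H := 2 * Nat.log 2 (outs.length + 1) + 1
    IsEdgeTree ang H (buildTree ang outs).ret ∧ (buildTree ang outs).ret.items.Perm outs ∧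
      (buildTree ang outs).ret.toList.length ≤ outs.length ∧
      (buildTree ang outs).time ≤ outs.length * (H + 2) := by
  intro H
  suffices key : ∀ (l : List E) (T : AVL ℝ (List E)), IsEdgeTree ang H T →
      T.toList.length + l.length ≤ outs.length →
      let r := l.foldlM (fun T e => do
        tick
        AVL.insert (ang e) e T) T
      IsEdgeTree ang H r.ret ∧ r.ret.items.Perm (l ++ T.items) ∧
        r.ret.toList.length ≤ outs.length ∧ r.time ≤ l.length * (H + 2) by
    have := key outs leaf ⟨by simp [Sorted, toList], trivial, by simp, by simp [toList]⟩
      (by simp [toList])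
    simpa [buildTree, items, toList] using this
  intro l
  induction l with
  | nil =>
    intro T hT hl
    refine ⟨hT, by simp, by simpa using hl, by simp⟩
  | cons e l ih =>
    intro T hT hl
    rw [List.length_cons] at hl
    obtain ⟨b1, -, -, b4⟩ := insert_bal (ang e) e T hT.bal
    obtain ⟨-, s2, s3, s4, s5⟩ := insert_spec ang e T hT.sorted hT.ang_eq
    obtain ⟨i1, i2, i3, i4⟩ := ih (AVL.insert (ang e) e T).ret
      ⟨s2, b1, ht_le_log _ b1 (by omega), s3⟩ (by omega)
    have := hT.ht_le
    simp only [List.foldlM_cons, ret_bind, time_bind, time_tick, List.length_cons]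
    refine ⟨i1, ?_, i3, ?_⟩
    · exact i2.trans ((s4.append_left l).trans List.perm_middle)
    · rw [Nat.add_mul, one_mul]; omega

/-! ### The loop over the sorted tuples -/

theorem mem_candidates (ang : E → ℝ) (θ : Fin n → ℝ) (D : E → WithTop ℝ) (ins : List E)
    (τ : Candidate E n) :
    τ ∈ (candidates ang θ D ins).ret ↔
      ∃ i ∈ ins, ∃ s, τ = ⟨i, ang i, s, D i + (θ s : WithTop ℝ)⟩ := by
  have inner : ∀ (i : E) (l : List (Fin n)) (L : List (Candidate E n)),
      τ ∈ (l.foldlM (fun L s => do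
        tick
        pure (⟨i, ang i, s, D i + (θ s : WithTop ℝ)⟩ :: L)) L : TimeM _).ret ↔
        (∃ s ∈ l, τ = ⟨i, ang i, s, D i + (θ s : WithTop ℝ)⟩) ∨ τ ∈ L := by
    intro i l
    induction l with
    | nil => simp
    | cons s l ih =>
      intro L
      rw [List.foldlM_cons, ret_bind, ih]
      simp only [ret_bind, ret_pure, List.mem_cons, exists_eq_or_imp]
      exact or_left_comm.trans or_assoc.symm
  suffices outer : ∀ (l : List E) (L : List (Candidate E n)),
      τ ∈ (l.foldlM (fun L i => do
        tick
        let a := ang i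
        let d := D i
        (List.finRange n).foldlM (fun L s => do
          tick
          pure (⟨i, a, s, d + (θ s : WithTop ℝ)⟩ :: L)) L) L : TimeM _).ret ↔
        (∃ i ∈ l, ∃ s, τ = ⟨i, ang i, s, D i + (θ s : WithTop ℝ)⟩) ∨ τ ∈ L by
    simpa [candidates] using outer ins []
  intro l
  induction l with
  | nil => simp
  | cons i l ih =>
    intro L
    rw [List.foldlM_cons, ret_bind, ih]
    simp only [ret_bind, inner, List.mem_finRange, true_and, List.mem_cons, exists_eq_or_imp]
    exact or_left_comm.trans or_assoc.symm

theorem candidates_time (ang : E → ℝ) (θ : Fin n → ℝ) (D : E → WithTop ℝ) (ins : List E) :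
    (candidates ang θ D ins).ret.length = ins.length * n ∧
      (candidates ang θ D ins).time = ins.length * (n + 1) := by
  have inner : ∀ (i : E) (l : List (Fin n)) (L : List (Candidate E n)),
      (l.foldlM (fun L s => do
        tick
        pure (⟨i, ang i, s, D i + (θ s : WithTop ℝ)⟩ :: L)) L : TimeM _).ret.length =
        l.length + L.length ∧
      (l.foldlM (fun L s => do
        tick
        pure (⟨i, ang i, s, D i + (θ s : WithTop ℝ)⟩ :: L)) L : TimeM _).time = l.length := by
    intro i l
    induction l with
    | nil => simp
    | cons s l ih =>
      intro L
      rw [List.foldlM_cons, ret_bind, time_bind, (ih _).1, (ih _).2]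
      simp only [ret_bind, time_bind, ret_pure, time_pure, time_tick, List.length_cons]
      omega
  suffices outer : ∀ (l : List E) (L : List (Candidate E n)),
      (l.foldlM (fun L i => do
        tick
        let a := ang i
        let d := D i
        (List.finRange n).foldlM (fun L s => do
          tick
          pure (⟨i, a, s, d + (θ s : WithTop ℝ)⟩ :: L)) L) L : TimeM _).ret.length =
        l.length * n + L.length ∧
      (l.foldlM (fun L i => do
        tick
        let a := ang i
        let d := D i
        (List.finRange n).foldlM (fun L s => do
          tick
          pure (⟨i, a, s, d + (θ s : WithTop ℝ)⟩ :: L)) L) L : TimeM _).time =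
        l.length * (n + 1) by
    simpa [candidates] using outer ins []
  intro l
  induction l with
  | nil => simp
  | cons i l ih =>
    intro L
    rw [List.foldlM_cons, ret_bind, time_bind, (ih _).1, (ih _).2]
    simp only [ret_bind, time_bind, time_tick, inner, List.length_finRange, List.length_cons]
    constructor <;> ring

/-- The assignments that a tuple makes. -/
def Candidate.assign (τ : Candidate E n) (e : E) : Assignment E := ⟨e, τ.edge, τ.value⟩

theorem assign_loop (τ : Candidate E n) (l : List E) (A : List (Assignment E)) :
    (l.foldlM (fun A e => do
      tick
      pure (⟨e, τ.edge, τ.value⟩ :: A)) A : TimeM (List (Assignment E))).ret.Perm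
        (l.map τ.assign ++ A) ∧
    (l.foldlM (fun A e => do
      tick
      pure (⟨e, τ.edge, τ.value⟩ :: A)) A : TimeM (List (Assignment E))).time = l.length := by
  induction l generalizing A with
  | nil => simp
  | cons e l ih =>
    rw [List.foldlM_cons, ret_bind, time_bind, (ih _).2]
    refine ⟨(ih _).1.trans ?_, ?_⟩
    · simp [Candidate.assign]
    · simp [Nat.add_comm]

/-- The potential of the entries `R` pays for their deletion and for the assignments to their edges.
The unspent `2 * R.length` is what their retrieval by the range query costs. -/
theorem delete_loop (ang : E → ℝ) (H : ℕ) (τ : Candidate E n) (R : List (ℝ × List E))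
    (T : AVL ℝ (List E)) (A : List (Assignment E)) (hT : IsEdgeTree ang H T) :
    let r : TimeM (AVL ℝ (List E) × List (Assignment E)) := R.foldlM (fun TA q => do
      tick
      let T' ← AVL.delete q.1 TA.1
      let A' ← q.2.foldlM (fun A e => do
        tick
        pure (⟨e, τ.edge, τ.value⟩ :: A)) TA.2
      pure (T', A')) (T, A)
    IsEdgeTree ang H r.ret.1 ∧
      r.ret.1.toList = T.toList.filter (fun q => q.1 ∉ R.map Prod.fst) ∧
      r.ret.2.Perm ((R.flatMap Prod.snd).map τ.assign ++ A) ∧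
      r.time + 2 * R.length ≤ potential H R := by
  induction R generalizing T A with
  | nil => simpa [potential] using hT
  | cons q R ih =>
    obtain ⟨d1, -, d3, d4⟩ := delete_bal q.1 T hT.bal
    have d5 := toList_delete q.1 T hT.sorted
    have hT' : IsEdgeTree ang H (AVL.delete q.1 T).ret :=
      ⟨by rw [Sorted, d5]; exact hT.sorted.filter _, d1, d3.trans hT.ht_le,
        fun p hp => hT.ang_eq p (by rw [d5] at hp; exact (List.mem_filter.1 hp).1)⟩
    obtain ⟨a1, a2⟩ := assign_loop τ q.2 A
    obtain ⟨i1, i2, i3, i4⟩ := ih (AVL.delete q.1 T).ret _ hT'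
    have := hT.ht_le
    intro r
    simp only [r, List.foldlM_cons, ret_bind, time_bind, ret_pure, time_pure, time_tick, a2]
    refine ⟨i1, ?_, ?_, ?_⟩
    · rw [i2, d5, List.filter_filter]
      refine List.filter_congr fun p _ => ?_
      by_cases hp : p.1 = q.1 <;> simp [hp]
    · refine i3.trans ?_
      rw [List.flatMap_cons, List.map_append, List.append_assoc]
      exact (a1.append_left _).trans (by
        rw [← List.append_assoc, ← List.append_assoc]
        exact List.perm_append_comm.append_right _)
    · simp only [potential, List.map_cons, List.sum_cons, List.length_cons] at i4 ⊢
      omega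

/-- The effect of the tuple `τ` with the ranges `Is` on the tree `T` and the assignments `A`: the
edges in the ranges move from the tree to the list of assignments. -/
structure Moved (ang : E → ℝ) (H : ℕ) (τ : Candidate E n) (Is : List (Range ℝ))
    (T : AVL ℝ (List E)) (A : List (Assignment E))
    (r : TimeM (AVL ℝ (List E) × List (Assignment E))) : Prop where
  tree : IsEdgeTree ang H r.ret.1
  exists_moved : ∃ N : List E, r.ret.2.Perm (N.map τ.assign ++ A) ∧
    T.items.Perm (N ++ r.ret.1.items) ∧ ∀ e ∈ N, ∃ I ∈ Is, I.mem (ang e)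
  not_mem : ∀ e ∈ r.ret.1.items, ∀ I ∈ Is, ¬ I.mem (ang e)
  time_le : r.time + potential H r.ret.1.toList ≤
    potential H T.toList + Is.length * (2 * H + 2)

theorem processRange_moved (ang : E → ℝ) (H : ℕ) (τ : Candidate E n) (T : AVL ℝ (List E))
    (A : List (Assignment E)) (I : Range ℝ) (hT : IsEdgeTree ang H T) :
    Moved ang H τ [I] T A (processRange τ T A I) := by
  have hR := getInbetween_perm I T hT.sorted []
  have tR := getInbetween_time I T hT.sorted hT.bal []
  rw [List.append_nil] at hR
  obtain ⟨d1, d2, d3, d4⟩ := delete_loop ang H τ (getInbetween I T []).ret T A hT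
  have hkeep : T.toList.filter
      (fun q => decide (q.1 ∉ (getInbetween I T []).ret.map Prod.fst)) =
      T.toList.filter (fun q => !I.mem q.1) := by
    refine List.filter_congr fun q hq => ?_
    have : q.1 ∈ (getInbetween I T []).ret.map Prod.fst ↔ I.mem q.1 := by
      simp only [List.mem_map, hR.mem_iff, List.mem_filter]
      exact ⟨fun ⟨p, hp, h⟩ => h ▸ hp.2, fun h => ⟨q, ⟨hq, h⟩, rfl⟩⟩
    by_cases h : I.mem q.1 <;> simp [this, h]
  rw [hkeep] at d2
  have hsplit := List.filter_append_perm (fun q : ℝ × List E => I.mem q.1) T.toList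
  have hang : ∀ {e}, ∀ q ∈ T.toList, e ∈ q.2 → ang e = q.1 := fun q hq he => hT.ang_eq q hq _ he
  refine ⟨d1, ⟨(getInbetween I T []).ret.flatMap Prod.snd, d3, ?_, ?_⟩, ?_, ?_⟩
  · refine (hsplit.symm.flatMap_right Prod.snd).trans ?_
    rw [List.flatMap_append]
    refine (hR.symm.flatMap_right Prod.snd).append ?_
    rw [items]
    exact .of_eq (congrArg _ d2.symm)
  · intro e he
    obtain ⟨q, hq, heq⟩ := List.mem_flatMap.1 he
    rw [hR.mem_iff, List.mem_filter] at hq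
    exact ⟨I, by simp, by rw [hang q hq.1 heq]; exact hq.2⟩
  · intro e he J hJ
    obtain rfl := List.mem_singleton.1 hJ
    obtain ⟨q, hq, heq⟩ := mem_items.1 he
    have hq' := d2 ▸ hq
    rw [List.mem_filter] at hq'
    rw [hang q hq'.1 heq]
    simpa using hq'.2
  · have p1 := potential_perm H hsplit
    rw [potential_append, ← potential_perm H hR] at p1
    have p2 := congrArg (potential H) d2
    have := hT.ht_le
    rw [← hR.length_eq] at tR
    simp only [processRange, time_bind, ret_bind, time_tick, List.length_singleton]
    simp only [potential] at *
    omega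

theorem processRanges_moved (ang : E → ℝ) (H : ℕ) (τ : Candidate E n) (Is : List (Range ℝ))
    (T : AVL ℝ (List E)) (A : List (Assignment E)) (hT : IsEdgeTree ang H T) :
    Moved ang H τ Is T A (Is.foldlM (fun TA I => processRange τ TA.1 TA.2 I) (T, A)) := by
  induction Is generalizing T A with
  | nil => exact ⟨hT, ⟨[], by simp, by simp, by simp⟩, by simp, by simp⟩
  | cons I Is ih =>
    obtain ⟨h1, ⟨N, h2, h3, h4⟩, h5, h6⟩ := processRange_moved ang H τ T A I hT
    obtain ⟨i1, ⟨N', i2, i3, i4⟩, i5, i6⟩ := ih _ (processRange τ T A I).ret.2 h1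
    refine ⟨i1, ⟨N ++ N', ?_, ?_, ?_⟩, ?_, ?_⟩
    · refine i2.trans ((h2.append_left _).trans ?_)
      rw [List.map_append, ← List.append_assoc]
      exact List.perm_append_comm.append_right _
    · exact h3.trans (by rw [List.append_assoc]; exact i3.append_left _)
    · intro e he
      rcases List.mem_append.1 he with he | he
      · obtain ⟨J, hJ, h⟩ := h4 e he
        exact ⟨J, by simp [List.mem_singleton.1 hJ], h⟩
      · obtain ⟨J, hJ, h⟩ := i4 e he
        exact ⟨J, by simp [hJ], h⟩
    · intro e he J hJ
      rcases List.mem_cons.1 hJ with rfl | hJ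
      · exact h5 e (i3.symm.subset (List.mem_append_right _ he)) J (by simp)
      · exact i5 e he J hJ
    · rw [List.foldlM_cons, ret_bind, time_bind, List.length_cons, Nat.add_mul, one_mul]
      simp only [List.length_singleton, one_mul] at h6
      simp only [Prod.mk.eta] at i6 ⊢
      omega

/-- The main loop assigns optimal predecessors. The invariant behind it (hypothesis `pending`) is
that for each edge `e` that is still in the tree and for each incoming edge `i`, the tuple that
offers to `e` the cost of a turn from `i` is still to come. As the tuples are sorted, the tuple that
removes `e` from the tree makes the best offer. -/
theorem processAll_spec (ang : E → ℝ) (H : ℕ) (θ : Fin n → ℝ) (γ : Fin (n + 1) → ℝ)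
    (D : E → WithTop ℝ) (ins : List E) (cc : E → E → ℝ)
    (hcc : ∀ i e s, Hits γ (ang i) s (ang e) → cc i e = θ s)
    (L : List (Candidate E n)) (T : AVL ℝ (List E))
    (hT : IsEdgeTree ang H T) (sorted : L.Pairwise (fun τ τ' => τ.value ≤ τ'.value))
    (valid : ∀ τ ∈ L, τ.edge ∈ ins ∧ τ.angle = ang τ.edge ∧
      τ.value = D τ.edge + (θ τ.step : WithTop ℝ))
    (pending : ∀ e ∈ T.items, ∀ i ∈ ins, ∃ τ ∈ L,
      τ.value = D i + (cc i e : WithTop ℝ) ∧ Hits γ τ.angle τ.step (ang e)) :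
    let r := processAll γ L T
    (∀ a ∈ r.ret.2, a.pred ∈ ins ∧ a.value = D a.pred + (cc a.pred a.out : WithTop ℝ) ∧
        ∀ i ∈ ins, a.value ≤ D i + (cc i a.out : WithTop ℝ)) ∧
      (r.ret.2.map Assignment.out ++ r.ret.1.items).Perm T.items ∧
      (ins ≠ [] → r.ret.1.items = []) ∧
      r.time ≤ potential H T.toList + L.length * (8 * H + 9) := by
  suffices key : ∀ (L : List (Candidate E n)) (T : AVL ℝ (List E)) (A : List (Assignment E)),
      IsEdgeTree ang H T → L.Pairwise (fun τ τ' => τ.value ≤ τ'.value) →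
      (∀ τ ∈ L, τ.edge ∈ ins ∧ τ.angle = ang τ.edge ∧
        τ.value = D τ.edge + (θ τ.step : WithTop ℝ)) →
      (∀ e ∈ T.items, ∀ i ∈ ins, ∃ τ ∈ L,
        τ.value = D i + (cc i e : WithTop ℝ) ∧ Hits γ τ.angle τ.step (ang e)) →
      let r : TimeM (AVL ℝ (List E) × List (Assignment E)) := L.foldlM (fun TA τ => do
        tick
        (feasibleRanges γ τ.angle τ.step).foldlM
          (fun TA I => processRange τ TA.1 TA.2 I) TA) (T, A)
      (∀ a ∈ r.ret.2, a ∈ A ∨ a.pred ∈ ins ∧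
          a.value = D a.pred + (cc a.pred a.out : WithTop ℝ) ∧
          ∀ i ∈ ins, a.value ≤ D i + (cc i a.out : WithTop ℝ)) ∧
        (r.ret.2.map Assignment.out ++ r.ret.1.items).Perm (A.map Assignment.out ++ T.items) ∧
        (ins ≠ [] → r.ret.1.items = []) ∧
        r.time + potential H r.ret.1.toList ≤
          potential H T.toList + L.length * (8 * H + 9) by
    obtain ⟨k1, k2, k3, k4⟩ := key L T [] hT sorted valid pending
    exact ⟨fun a ha => (k1 a ha).resolve_left (by simp), by simpa [processAll] using k2, k3,
      (Nat.le_add_right _ _).trans k4⟩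
  clear! L T
  intro L
  induction L with
  | nil =>
    intro T A hT _ _ pending
    refine ⟨fun a ha => Or.inl ha, .refl _, fun hins => ?_, by simp⟩
    obtain ⟨i, hi⟩ := List.exists_mem_of_ne_nil _ hins
    refine List.eq_nil_iff_forall_not_mem.2 fun e he => ?_
    obtain ⟨τ, hτ, -⟩ := pending e he i hi
    simp at hτ
  | cons τ L ih =>
    intro T A hT sorted valid pending
    obtain ⟨s1, s2⟩ := List.pairwise_cons.1 sorted
    obtain ⟨v1, v2, v3⟩ := valid τ (by simp)
    obtain ⟨h1, ⟨N, h2, h3, h4⟩, h5, h6⟩ :=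
      processRanges_moved ang H τ (feasibleRanges γ τ.angle τ.step) T A hT
    intro r
    simp only [r, List.foldlM_cons, ret_bind, time_bind, time_tick]
    generalize (feasibleRanges γ τ.angle τ.step).foldlM
      (fun TA I => processRange τ TA.1 TA.2 I) (T, A) = q at *
    obtain ⟨⟨T', A'⟩, t⟩ := q
    dsimp only at h1 h2 h3 h5 h6 ⊢
    have pending' : ∀ e ∈ T'.items, ∀ i ∈ ins, ∃ τ ∈ L,
        τ.value = D i + (cc i e : WithTop ℝ) ∧ Hits γ τ.angle τ.step (ang e) := by
      intro e he i hi
      obtain ⟨τ', hτ', hv, ⟨I, hI, hm⟩⟩ :=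
        pending e (h3.symm.subset (List.mem_append_right _ he)) i hi
      rcases List.mem_cons.1 hτ' with rfl | hτ'
      · exact absurd hm (h5 e he I hI)
      · exact ⟨τ', hτ', hv, I, hI, hm⟩
    obtain ⟨i1, i2, i3, i4⟩ := ih T' A' h1 s2 (fun τ' h => valid τ' (by simp [h])) pending'
    refine ⟨fun a ha => ?_, ?_, i3, ?_⟩
    · rcases i1 a ha with ha | ha
      · rcases List.mem_append.1 (h2.subset ha) with ha | ha
        · obtain ⟨e, he, rfl⟩ := List.mem_map.1 ha
          obtain ⟨I, hI, hm⟩ := h4 e he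
          refine Or.inr ⟨v1, ?_, fun i hi => ?_⟩
          · have := hcc τ.edge e τ.step (by rw [← v2]; exact ⟨I, hI, hm⟩)
            simp only [Candidate.assign, this, v3]
          · obtain ⟨τ', hτ', hv, -⟩ :=
              pending e (h3.symm.subset (List.mem_append_left _ he)) i hi
            simp only [Candidate.assign, ← hv]
            rcases List.mem_cons.1 hτ' with rfl | hτ'
            · exact le_rfl
            · exact s1 τ' hτ'
        · exact Or.inl ha
      · exact Or.inr ha
    · refine i2.trans ?_
      have e1 : (A'.map Assignment.out).Perm (N ++ A.map Assignment.out) := by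
        have := h2.map Assignment.out
        simpa [Function.comp_def, Candidate.assign] using this
      refine (e1.append_right _).trans ?_
      refine (List.perm_append_comm.append_right _).trans ?_
      rw [List.append_assoc]
      exact h3.symm.append_left _
    · have : (feasibleRanges γ τ.angle τ.step).length = 4 := rfl
      rw [this] at h6
      rw [List.length_cons, Nat.add_mul, one_mul]
      omega

end Update

/-! ### The update rule at one vertex -/

section StepUpdate

variable {V E : Type} (G : PlaneDigraph V E) {n : ℕ} {c : ℝ → ℝ} {θ : Fin n → ℝ}
  {γ : Fin (n + 1) → ℝ}

theorem stepUpdate_spec (h : IsStepFunction c θ γ) {w : ℂ} (hw : w ≠ 0) (v : V)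
    (D : E → WithTop ℝ) :
    IsOptimalAssignment G c v D (stepUpdate (G.direction w) θ γ (G.ins v) (G.outs v) D).ret ∧
      (stepUpdate (G.direction w) θ γ (G.ins v) (G.outs v) D).time ≤
        43 * ((n * G.inDeg v + G.outDeg v + 1) *
          Nat.log 2 (n * G.inDeg v * G.outDeg v + 2)) := by
  have hlog : 1 ≤ Nat.log 2 (n * G.inDeg v * G.outDeg v + 2) :=
    Nat.log_pos (by norm_num) (by omega)
  by_cases hempty : ((G.ins v).isEmpty || (G.outs v).isEmpty) = true
  · simp only [stepUpdate, hempty, if_true, ret_bind, time_bind, ret_pure, time_pure, time_tick]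
    refine ⟨⟨by simp, fun h1 f h2 => ?_, by simp⟩, ?_⟩
    · rw [Bool.or_eq_true, List.isEmpty_iff, List.isEmpty_iff] at hempty
      rcases hempty with h0 | h0
      · exact absurd h0 h1
      · simp [h0] at h2
    · have : 1 ≤ (n * G.inDeg v + G.outDeg v + 1) *
          Nat.log 2 (n * G.inDeg v * G.outDeg v + 2) := Nat.mul_pos (by omega) hlog
      omega
  · obtain ⟨t1, t2, t3, t4⟩ := buildTree_spec (G.direction w) (G.outs v)
    obtain ⟨c1, c2⟩ := candidates_time (G.direction w) θ D (G.ins v)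
    have c3 := mem_candidates (G.direction w) θ D (G.ins v)
    set L := (candidates (G.direction w) θ D (G.ins v)).ret with hL
    set T := (buildTree (G.direction w) (G.outs v)).ret with hT
    set H := 2 * Nat.log 2 ((G.outs v).length + 1) + 1 with hH
    obtain ⟨m1, m2⟩ := mergeSort_spec Candidate.value L
    have m3 := mergeSort_time Candidate.value L _ (Nat.lt_pow_succ_log_self one_lt_two _).le
    obtain ⟨p1, p2, p3, p4⟩ := processAll_spec (G.direction w) H θ γ D (G.ins v)
      (fun i e => c (G.turn i e)) (fun i e s hs => cost_turn_of_hits G h hw hs)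
      (mergeSort Candidate.value L).ret T t1 m2
      (by
        intro τ hτ
        obtain ⟨i, hi, s, rfl⟩ := (c3 τ).1 (m1.subset hτ)
        exact ⟨hi, rfl, rfl⟩)
      (by
        intro e _ i hi
        obtain ⟨s, hs⟩ := exists_hits G h hw i e
        refine ⟨_, m1.symm.subset ((c3 _).2 ⟨i, hi, s, rfl⟩), ?_, hs⟩
        rw [cost_turn_of_hits G h hw hs])
    simp only [stepUpdate, hempty, Bool.false_eq_true, if_false, ret_bind, time_bind, ret_pure,
      time_pure, time_tick, ← hL, ← hT]
    rw [Bool.or_eq_true, List.isEmpty_iff, List.isEmpty_iff, not_or] at hempty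
    rw [p3 hempty.1, List.append_nil] at p2
    have hperm := p2.trans t2
    refine ⟨⟨hperm.nodup_iff.2 (G.outs_nodup v), fun _ f hf => ?_, fun a ha => ?_⟩, ?_⟩
    · exact List.mem_map.1 (hperm.symm.subset hf)
    · exact ⟨hperm.subset (List.mem_map_of_mem ha), p1 a ha⟩
    · have hk := List.length_pos_iff.2 hempty.1
      have hl := List.length_pos_iff.2 hempty.2
      have hn := h.pos
      rw [potential_eq] at p4
      have hitems : (T.toList.flatMap Prod.snd).length = (G.outs v).length := t2.length_eq
      rw [hitems, m1.length_eq, c1] at p4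
      rw [c1] at m3
      rw [c2]
      unfold PlaneDigraph.inDeg PlaneDigraph.outDeg at *
      set k := (G.ins v).length
      set l := (G.outs v).length
      have hm : 1 ≤ k * n := Nat.mul_pos hk hn
      have hH' : H ≤ 3 * Nat.log 2 (n * k * l + 2) := by
        have : Nat.log 2 (l + 1) ≤ Nat.log 2 (n * k * l + 2) :=
          Nat.log_mono_right (by nlinarith)
        omega
      have hd : Nat.log 2 (k * n) + 1 ≤ 2 * Nat.log 2 (n * k * l + 2) := by
        have : Nat.log 2 (k * n) ≤ Nat.log 2 (n * k * l + 2) :=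
          Nat.log_mono_right (by nlinarith)
        omega
      have hkm : k ≤ k * n := Nat.le_mul_of_pos_right k hn
      rw [Nat.mul_comm n k] at *
      set m := k * n
      set Λ := Nat.log 2 (m * l + 2)
      -- `e1` bounds the insertions, `e2` the listing of the `m` tuples, `e3` the sorting, `e4` the
      -- tuples in the main loop, and `e5` the potential of the initial tree
      have e1 : l * (H + 2) ≤ l * (5 * Λ) := Nat.mul_le_mul_left _ (by omega)
      have e2 : k * (n + 1) ≤ 2 * m := by rw [Nat.mul_add]; omega
      have e3 : 3 * m * (Nat.log 2 m + 1) ≤ 3 * m * (2 * Λ) := Nat.mul_le_mul_left _ hd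
      have e4 : m * (8 * H + 9) ≤ m * (33 * Λ) := Nat.mul_le_mul_left _ (by omega)
      have e5 : T.toList.length * (H + 4) ≤ l * (7 * Λ) := Nat.mul_le_mul t3 (by omega)
      have e6 : m ≤ m * Λ := Nat.le_mul_of_pos_right _ hlog
      have e7 : l ≤ l * Λ := Nat.le_mul_of_pos_right _ hlog
      nlinarith

/-- Each outgoing edge gets at most one assignment, so the relaxation takes time at most the
out-degree. -/
theorem length_le_outDeg {v : V} {D : E → WithTop ℝ} {A : List (Assignment E)}
    (hA : IsOptimalAssignment G c v D A) : A.length ≤ G.outDeg v := by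
  have h1 : (A.map Assignment.out).Subperm (G.outs v) :=
    List.subperm_of_subset hA.1 fun e he => by
      obtain ⟨a, ha, rfl⟩ := List.mem_map.1 he
      exact (hA.2.2 a ha).1
  simpa [PlaneDigraph.outDeg] using h1.length_le

end StepUpdate

/-! ### Walks and their extensions -/

section Walks

variable {V E : Type} (G : PlaneDigraph V E) (cost : E → ℝ) (c : ℝ → ℝ)

/-- There is a walk that begins with the edge `e`, ends with the edge `f` and costs `x` more than
the edge `e` alone. -/
inductive Ext (e : E) : E → ℝ → Prop
  | refl : Ext e e 0
  | step {f g : E} {x : ℝ} : Ext e f x → G.tgt f = G.src g → Ext e g (x + c (G.turn f g) + cost g)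

/-- There is a walk of cost `x` that begins in the vertex `s` and ends with the edge `e`. -/
def Reach (s : V) (e : E) (x : ℝ) : Prop :=
  ∃ e₀ y, G.src e₀ = s ∧ Ext G cost c e₀ e y ∧ x = cost e₀ + y

variable {G cost c}

theorem Ext.trans {e f g : E} {x y : ℝ} (h : Ext G cost c e f x) (h' : Ext G cost c f g y) :
    Ext G cost c e g (x + y) := by
  induction h' with
  | refl => simpa using h
  | step _ h2 ih => simpa [add_assoc] using ih.step h2

theorem Reach.ext {s : V} {e f : E} {x y : ℝ} (h : Reach G cost c s e x)
    (h' : Ext G cost c e f y) : Reach G cost c s f (x + y) := by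
  obtain ⟨e₀, z, h1, h2, rfl⟩ := h
  exact ⟨e₀, z + y, h1, h2.trans h', by ring⟩

theorem Ext.single {e f : E} (h : G.tgt e = G.src f) :
    Ext G cost c e f (c (G.turn e f) + cost f) := by
  simpa using (Ext.refl (G := G) (cost := cost) (c := c) (e := e)).step h

theorem Reach.start {s : V} {e : E} (h : G.src e = s) : Reach G cost c s e (cost e) :=
  ⟨e, 0, h, .refl, by simp⟩

theorem Reach.step {s : V} {e f : E} {x : ℝ} (h : Reach G cost c s e x)
    (h' : G.tgt e = G.src f) : Reach G cost c s f (x + c (G.turn e f) + cost f) := by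
  rw [add_assoc]
  exact h.ext (.single h')

namespace PlaneDigraph

theorem ne_of_tgt_eq_src {e f : E} (h : G.tgt e = G.src f) : e ≠ f := by
  rintro rfl
  exact G.pos_ne e (congrArg G.pos h.symm)

theorem isWalk_singleton {s t : V} {e : E} : G.IsWalk s t [e] ↔ G.src e = s ∧ G.tgt e = t := by
  simp [IsWalk]

theorem isWalk_snoc {s t : V} {l : List E} {e f : E} :
    G.IsWalk s t (l ++ [e] ++ [f]) ↔
      G.IsWalk s (G.tgt e) (l ++ [e]) ∧ G.tgt e = G.src f ∧ G.tgt f = t := by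
  have hhead : (l ++ [e] ++ [f]).head? = (l ++ [e]).head? := by cases l <;> simp
  rw [IsWalk, IsWalk, hhead, List.isChain_append]
  simp only [List.getLast?_append, List.getLast?_singleton, List.head?_cons, Option.some_or,
    Option.mem_def, Option.some.injEq, forall_eq', Option.map_some, List.isChain_singleton]
  tauto

theorem walkCost_snoc (l : List E) (e f : E) :
    G.walkCost cost c (l ++ [e] ++ [f]) =
      G.walkCost cost c (l ++ [e]) + c (G.turn e f) + cost f := by
  induction l with
  | nil => simp [walkCost]
  | cons a l ih =>
    cases l with
    | nil => simp [walkCost]; ring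
    | cons b l =>
      simp only [List.cons_append, walkCost] at ih ⊢
      rw [ih]; ring

theorem IsWalk.exists_eq_append {s t : V} {w : List E} (h : G.IsWalk s t w) :
    ∃ l e, w = l ++ [e] ∧ G.tgt e = t := by
  rcases List.eq_nil_or_concat w with rfl | ⟨l, e, rfl⟩
  · simp [IsWalk] at h
  · exact ⟨l, e, by simp, by simpa [IsWalk] using h.2.2⟩

end PlaneDigraph

theorem Ext.exists_walk {s : V} {e f : E} {y : ℝ} (he : G.src e = s)
    (h : Ext G cost c e f y) :
    ∃ l, G.IsWalk s (G.tgt f) (l ++ [f]) ∧ G.walkCost cost c (l ++ [f]) = cost e + y := by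
  induction h with
  | refl => exact ⟨[], PlaneDigraph.isWalk_singleton.2 ⟨he, rfl⟩, by simp [PlaneDigraph.walkCost]⟩
  | @step f g x _ h2 ih =>
    obtain ⟨l, h3, h4⟩ := ih
    exact ⟨l ++ [f], PlaneDigraph.isWalk_snoc.2 ⟨h3, h2, rfl⟩, by
      rw [PlaneDigraph.walkCost_snoc, h4]; ring⟩

theorem Reach.exists_walk {s : V} {e : E} {x : ℝ} (h : Reach G cost c s e x) :
    ∃ w, G.IsWalk s (G.tgt e) w ∧ G.walkCost cost c w = x := by
  obtain ⟨e₀, y, h1, h2, rfl⟩ := h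
  obtain ⟨l, h⟩ := h2.exists_walk h1
  exact ⟨_, h⟩

/-- If the costs of the walks from `s` to `t` are bounded below, no closed walk that can be reached
from `s` and left towards `t` has negative cost: one could go around it arbitrarily often. -/
theorem Ext.nonneg_of_bounded {s t : V} {μ : ℝ}
    (hμ : ∀ w, G.IsWalk s t w → μ ≤ G.walkCost cost c w) {f g : E} {x y z : ℝ}
    (hx : Reach G cost c s f x) (hz : Ext G cost c f g z) (hg : G.tgt g = t)
    (hy : Ext G cost c f f y) : 0 ≤ y := by
  by_contra! hneg
  have pump : ∀ k : ℕ, Reach G cost c s f (x + k * y) := fun k => by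
    induction k with
    | zero => simpa using hx
    | succ k ih =>
      have := ih.ext hy
      push_cast
      rwa [add_one_mul, ← add_assoc]
  obtain ⟨k, hk⟩ := exists_nat_gt ((x + z - μ) / -y)
  rw [div_lt_iff₀ (by linarith)] at hk
  obtain ⟨w, hw, hc⟩ := ((pump k).ext hz).exists_walk
  have := hμ w (hg ▸ hw)
  linarith

end Walks

/-! ### Invariants of the distances and predecessors -/

section Invariants

variable {V E : Type} [DecidableEq E] (G : PlaneDigraph V E) (cost : E → ℝ) (c : ℝ → ℝ)

/-- `M'` is obtained from `M` by an improvement of the distance of one edge `f` with the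
predecessor `i`. -/
def Memory.Improves (M M' : Memory E) : Prop :=
  ∃ (i f : E) (y : ℝ), G.tgt i = G.src f ∧ M.D i = (y : WithTop ℝ) ∧
    ((y + c (G.turn i f) + cost f : ℝ) : WithTop ℝ) < M.D f ∧
    M' = M.write f ((y + c (G.turn i f) + cost f : ℝ) : WithTop ℝ) (some i)

/-- Each finite distance is at least the cost of the step from the predecessor, with the current
distance of the predecessor; edges without a predecessor begin in `s`. -/
def Memory.Consistent (s : V) (M : Memory E) : Prop :=
  ∀ e (x : ℝ), M.D e = x → (M.P e = none ∧ G.src e = s ∧ x = cost e) ∨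
    ∃ (f : E) (y : ℝ), M.P e = some f ∧ G.tgt f = G.src e ∧ M.D f = (y : WithTop ℝ) ∧
      y + c (G.turn f e) + cost e ≤ x

/-- Each finite distance is the cost of a walk. -/
def Memory.Attained (s : V) (M : Memory E) : Prop :=
  ∀ e (x : ℝ), M.D e = x → Reach G cost c s e x

/-- Following the predecessors from an edge from which `t` can be reached never leads into a
cycle. -/
def Memory.Acyclic (t : V) (M : Memory E) : Prop :=
  ∀ e (x : ℝ), M.D e = x → (∃ g z, G.tgt g = t ∧ Ext G cost c e g z) →
    Acc (fun a b => M.P b = some a) e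

variable {G cost c} {M M' : Memory E} {s t : V}

theorem Memory.write_D (M : Memory E) (f e : E) (d : WithTop ℝ) (q : Option E) :
    (M.write f d q).D e = if e = f then d else M.D e := by
  simp [Memory.write, Function.update_apply]

theorem Memory.write_P (M : Memory E) (f e : E) (d : WithTop ℝ) (q : Option E) :
    (M.write f d q).P e = if e = f then q else M.P e := by
  simp [Memory.write, Function.update_apply]

theorem Memory.Improves.le (h : M.Improves G cost c M') (e : E) : M'.D e ≤ M.D e := by
  obtain ⟨i, f, y, -, -, hlt, rfl⟩ := h
  rw [write_D]
  split_ifs with he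
  · rw [he]; exact hlt.le
  · exact le_rfl

theorem Memory.Attained.improves (hM : M.Attained G cost c s) (h : M.Improves G cost c M') :
    M'.Attained G cost c s := by
  obtain ⟨i, f, y, hif, hy, -, rfl⟩ := h
  intro e x hx
  rw [write_D] at hx
  split_ifs at hx with he
  · subst he
    rw [← WithTop.coe_injective hx]
    exact (hM i y hy).step hif
  · exact hM e x hx

theorem Memory.Consistent.improves (hM : M.Consistent G cost c s)
    (h : M.Improves G cost c M') : M'.Consistent G cost c s := by
  obtain ⟨i, f, y, hif, hy, hlt, rfl⟩ := h
  intro e x hx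
  rw [write_D] at hx
  rw [write_P]
  split_ifs at hx ⊢ with he
  · subst he
    refine Or.inr ⟨i, y, rfl, hif, ?_, (WithTop.coe_injective hx).le⟩
    rw [write_D, if_neg (PlaneDigraph.ne_of_tgt_eq_src hif), hy]
  · rcases hM e x hx with h | ⟨g, y', h1, h2, h3, h4⟩
    · exact Or.inl h
    · right
      by_cases hg : g = f
      · subst hg
        rw [h3, WithTop.coe_lt_coe] at hlt
        exact ⟨g, _, h1, h2, by rw [write_D, if_pos rfl], by linarith⟩
      · exact ⟨g, y', h1, h2, by rw [write_D, if_neg hg, h3], h4⟩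

/-- An improvement of `f` with the predecessor `i` could close a cycle only if the predecessors led
from `i` back to `f`. By consistency this cycle would have negative cost. -/
theorem Memory.Acyclic.improves (hM : M.Acyclic G cost c t) (hC : M.Consistent G cost c s)
    (hA : M.Attained G cost c s) {μ : ℝ}
    (hμ : ∀ w, G.IsWalk s t w → μ ≤ G.walkCost cost c w) (h : M.Improves G cost c M') :
    M'.Acyclic G cost c t := by
  obtain ⟨i, f, y, hif, hy, hlt, rfl⟩ := h
  set M' := M.write f ((y + c (G.turn i f) + cost f : ℝ) : WithTop ℝ) (some i) with hM'
  have hP : ∀ g, g ≠ f → M'.P g = M.P g := fun g hg => by rw [hM', write_P, if_neg hg]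
  have hPf : M'.P f = some i := by rw [hM', write_P, if_pos rfl]
  have lift : ∀ {g h}, M'.P g = some h → Acc (fun a b => M'.P b = some a) h →
      Acc (fun a b => M'.P b = some a) g := fun hg hh =>
    ⟨_, fun a ha => (Option.some.inj (hg.symm.trans ha)) ▸ hh⟩
  -- the predecessors of `g` avoid `f`, or they lead to `f` along a walk that is not too expensive
  have back : ∀ g, Acc (fun a b => M.P b = some a) g → ∀ x : ℝ, M.D g = x →
      Acc (fun a b => M'.P b = some a) g ∨
        ∃ u z : ℝ, M.D f = u ∧ Ext G cost c f g z ∧ u + z ≤ x := by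
    intro g hg
    induction hg with
    | intro g _ ih =>
      intro x hx
      by_cases hgf : g = f
      · exact Or.inr ⟨x, 0, hgf ▸ hx, hgf ▸ .refl, by simp⟩
      · rcases hC g x hx with ⟨h1, -, -⟩ | ⟨h, y', h1, h2, h3, h4⟩
        · exact Or.inl ⟨_, fun a ha => by rw [hP g hgf, h1] at ha; simp at ha⟩
        · rcases ih h h1 y' h3 with h5 | ⟨u, z, h5, h6, h7⟩
          · exact Or.inl (lift ((hP g hgf).trans h1) h5)
          · exact Or.inr ⟨u, _, h5, h6.step h2, by linarith⟩
  have accf : (∃ g z, G.tgt g = t ∧ Ext G cost c f g z) →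
      Acc (fun a b => M'.P b = some a) f := by
    rintro ⟨g, z, hg, hz⟩
    refine lift hPf ((back i (hM i y hy ⟨g, _, hg, (Ext.single hif).trans hz⟩) y hy).resolve_right
      ?_)
    rintro ⟨u, z', hu, hz', hle⟩
    have hpos := Ext.nonneg_of_bounded hμ (hA f u hu) hz hg (hz'.step hif)
    rw [hu, WithTop.coe_lt_coe] at hlt
    linarith
  have other : ∀ e, Acc (fun a b => M.P b = some a) e → ∀ x : ℝ, M.D e = x →
      (∃ g z, G.tgt g = t ∧ Ext G cost c e g z) → Acc (fun a b => M'.P b = some a) e := by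
    intro e he
    induction he with
    | intro e _ ih =>
      rintro x hx ⟨g, z, hg, hz⟩
      by_cases hef : e = f
      · exact hef ▸ accf ⟨g, z, hg, hef ▸ hz⟩
      · rcases hC e x hx with ⟨h1, -, -⟩ | ⟨h, y', h1, h2, h3, -⟩
        · exact ⟨_, fun a ha => by rw [hP e hef, h1] at ha; simp at ha⟩
        · exact lift ((hP e hef).trans h1) (ih h h1 y' h3 ⟨g, _, hg, (Ext.single h2).trans hz⟩)
  intro e x hx hrel
  by_cases hef : e = f
  · exact hef ▸ accf (hef ▸ hrel)
  · rw [hM', write_D, if_neg hef] at hx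
    exact other e (hM e x hx hrel) x hx hrel

end Invariants

/-! ### Initialization and rounds -/

section Rounds

variable {V E : Type} [DecidableEq E] (G : PlaneDigraph V E) {n : ℕ} {c : ℝ → ℝ}
  {θ : Fin n → ℝ} {γ : Fin (n + 1) → ℝ} (cost : E → ℝ)

theorem write_loop (g : E → WithTop ℝ) (l : List E) (M : Memory E) (e : E) :
    let r : TimeM (Memory E) := l.foldlM (fun M e => do
      tick
      pure (M.write e (g e) none)) M
    (r.ret.D e = if e ∈ l then g e else M.D e) ∧
      (r.ret.P e = if e ∈ l then none else M.P e) ∧ r.time = l.length := by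
  induction l generalizing M with
  | nil => simp
  | cons a l ih =>
    obtain ⟨h1, h2, h3⟩ := ih (M.write a (g a) none)
    intro r
    simp only [r, List.foldlM_cons, ret_bind, time_bind, ret_pure, time_pure, time_tick]
    refine ⟨?_, ?_, ?_⟩
    · rw [h1, Memory.write_D]
      by_cases h : e = a <;> by_cases h' : e ∈ l <;> simp [h, h']
    · rw [h2, Memory.write_P]
      by_cases h : e = a <;> by_cases h' : e ∈ l <;> simp [h, h']
    · rw [h3, List.length_cons]; omega

open Classical in
theorem initMemory_spec (s : V) (M : Memory E) (e : E) :
    ((initMemory G cost s M).ret.D e = if G.src e = s then (cost e : WithTop ℝ) else ⊤) ∧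
      (initMemory G cost s M).ret.P e = none ∧
      (initMemory G cost s M).time = G.edges.length + G.outDeg s := by
  obtain ⟨h1, h2, h3⟩ := write_loop (fun _ => ⊤) G.edges M e
  obtain ⟨h4, h5, h6⟩ := write_loop (fun e => (cost e : WithTop ℝ)) (G.outs s)
    (G.edges.foldlM (fun M e => do
      tick
      pure (M.write e ⊤ none)) M : TimeM (Memory E)).ret e
  simp only [initMemory, ret_bind, time_bind]
  refine ⟨?_, ?_, ?_⟩
  · rw [h4, h1]; simp [G.mem_outs, G.mem_edges]
  · rw [h5, h2]; simp [G.mem_edges]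
  · rw [h3, h6, PlaneDigraph.outDeg]

variable {cost}

/-- The relaxation at a vertex is a sequence of improvements: it does not change the distances of
incoming edges, because no edge is a loop. -/
theorem relax_induction {v : V} {M : Memory E} {A : List (Assignment E)}
    (hA : IsOptimalAssignment G c v M.D A) {inv : Memory E → Prop}
    (hinv : ∀ M M', inv M → M.Improves G cost c M' → inv M') (hM : inv M) :
    inv (relax cost A M).ret := by
  refine (foldlM_ret_induction _ (fun M' => inv M' ∧ ∀ i ∈ G.ins v, M'.D i = M.D i) A M
    ⟨hM, fun _ _ => rfl⟩ ?_).1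
  rintro M' a ha ⟨h1, h2⟩
  obtain ⟨hout, hpred, hval, -⟩ := hA.2.2 a ha
  rw [ret_bind]
  split_ifs with hlt
  · rw [← h2 a.pred hpred] at hval
    cases hD : M'.D a.pred with
    | top => simp [hval, hD] at hlt
    | coe y =>
      have hturn : G.tgt a.pred = G.src a.out :=
        ((G.mem_ins v _).1 hpred).trans ((G.mem_outs v _).1 hout).symm
      have hnew : a.value + (cost a.out : WithTop ℝ) =
          ((y + c (G.turn a.pred a.out) + cost a.out : ℝ) : WithTop ℝ) := by
        rw [hval, hD]; push_cast; rfl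
      rw [hnew] at hlt ⊢
      refine ⟨hinv M' _ h1 ⟨a.pred, a.out, y, hturn, hD, hlt, rfl⟩, fun i hi => ?_⟩
      rw [ret_pure, Memory.write_D, if_neg, h2 i hi]
      exact PlaneDigraph.ne_of_tgt_eq_src (((G.mem_ins v i).1 hi).trans ((G.mem_outs v _).1 hout).symm)
  · exact ⟨h1, h2⟩

theorem relax_D_le (A : List (Assignment E)) (M : Memory E) :
    (∀ e, (relax cost A M).ret.D e ≤ M.D e) ∧
      ∀ a ∈ A, (relax cost A M).ret.D a.out ≤ a.value + (cost a.out : WithTop ℝ) := by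
  induction A generalizing M with
  | nil => simp [relax]
  | cons a A ih =>
    have hstep : ∃ M', (relax cost (a :: A) M).ret = (relax cost A M').ret ∧
        (∀ e, M'.D e ≤ M.D e) ∧ M'.D a.out ≤ a.value + (cost a.out : WithTop ℝ) := by
      refine ⟨_, rfl, ?_⟩
      rw [ret_bind]
      split_ifs with hlt
      · refine ⟨fun e => ?_, ?_⟩ <;> rw [ret_pure, Memory.write_D]
        · split_ifs with he
          · rw [he]; exact hlt.le
          · exact le_rfl
        · rw [if_pos rfl]
      · exact ⟨fun _ => le_rfl, not_lt.1 hlt⟩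
    obtain ⟨M', h1, h2, h3⟩ := hstep
    rw [h1]
    refine ⟨fun e => ((ih M').1 e).trans (h2 e), fun b hb => ?_⟩
    rcases List.mem_cons.1 hb with rfl | hb
    · exact ((ih M').1 _).trans h3
    · exact (ih M').2 b hb

theorem bfRound_induction (h : IsStepFunction c θ γ) {w : ℂ} (hw : w ≠ 0)
    {inv : Memory E → Prop} (hinv : ∀ M M', inv M → M.Improves G cost c M' → inv M')
    {M : Memory E} (hM : inv M) : inv (bfRound G w cost θ γ M).ret :=
  foldlM_ret_induction _ inv _ _ hM fun M v _ hM =>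
    relax_induction G (stepUpdate_spec G h hw v M.D).1 hinv hM

/-- After a round, no distance exceeds what the distances before the round offer. -/
theorem bfRound_D_le (h : IsStepFunction c θ γ) {w : ℂ} (hw : w ≠ 0) (M : Memory E) {i f : E}
    (hif : G.tgt i = G.src f) :
    (bfRound G w cost θ γ M).ret.D f ≤
      M.D i + (c (G.turn i f) : WithTop ℝ) + (cost f : WithTop ℝ) := by
  have mono : ∀ (l : List V) (M₀ : Memory E) (e : E),
      (l.foldlM (fun M v => do
        tick
        let A ← stepUpdate (G.direction w) θ γ (G.ins v) (G.outs v) M.D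
        relax cost A M) M₀ : TimeM (Memory E)).ret.D e ≤ M₀.D e := fun l M₀ e =>
    foldlM_ret_induction _ (fun M : Memory E => M.D e ≤ M₀.D e) l M₀ le_rfl fun M v _ hM =>
      ((relax_D_le _ M).1 e).trans hM
  obtain ⟨l₁, l₂, hl⟩ := List.append_of_mem (G.mem_verts (G.src f))
  rw [bfRound, hl, List.foldlM_append, ret_bind, List.foldlM_cons, ret_bind]
  refine (mono l₂ _ f).trans ?_
  generalize hM₁ : (l₁.foldlM (fun M v => do
        tick
        let A ← stepUpdate (G.direction w) θ γ (G.ins v) (G.outs v) M.D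
        relax cost A M) M : TimeM (Memory E)).ret = M₁
  have hi : M₁.D i ≤ M.D i := hM₁ ▸ mono l₁ M i
  have hins : i ∈ G.ins (G.src f) := (G.mem_ins _ i).2 hif
  obtain ⟨-, hA1, hA2⟩ := (stepUpdate_spec G h hw (G.src f) M₁.D).1
  obtain ⟨a, ha, hout⟩ := hA1 (List.ne_nil_of_mem hins) f ((G.mem_outs _ f).2 rfl)
  have h1 := (relax_D_le (cost := cost) _ M₁).2 a ha
  have h2 := (hA2 a ha).2.2.2 i hins
  rw [hout] at h1 h2
  exact h1.trans (add_le_add_left (h2.trans (add_le_add_left hi _)) _)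

/-- The memory after `p` rounds. -/
noncomputable def rounds (w : ℂ) (cost : E → ℝ) (θ : Fin n → ℝ) (γ : Fin (n + 1) → ℝ) (p : ℕ)
    (M : Memory E) : TimeM (Memory E) :=
  (List.range p).foldlM (fun M _ => do
    tick
    bfRound G w cost θ γ M) M

theorem rounds_succ_ret (w : ℂ) (cost : E → ℝ) (θ : Fin n → ℝ) (γ : Fin (n + 1) → ℝ) (p : ℕ)
    (M : Memory E) : (rounds G w cost θ γ (p + 1) M).ret =
      (bfRound G w cost θ γ (rounds G w cost θ γ p M).ret).ret := by
  rw [rounds, List.range_succ, List.foldlM_append]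
  rfl

/-- After `p` rounds, the distance of `e` is at most the cost of each walk from `s` that ends with
`e` and has at most `p + 1` edges. -/
theorem rounds_D_le (h : IsStepFunction c θ γ) {w : ℂ} (hw : w ≠ 0) (s : V) (M₀ : Memory E)
    (p : ℕ) (l : List E) (e : E) (hl : G.IsWalk s (G.tgt e) (l ++ [e])) (hp : l.length ≤ p) :
    (rounds G w cost θ γ p (initMemory G cost s M₀).ret).ret.D e ≤
      (G.walkCost cost c (l ++ [e]) : WithTop ℝ) := by
  have single : ∀ (p : ℕ) (e : E), G.src e = s →
      (rounds G w cost θ γ p (initMemory G cost s M₀).ret).ret.D e ≤ (cost e : WithTop ℝ) :=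
    fun p e he => foldlM_ret_induction _ (fun M : Memory E => M.D e ≤ (cost e : WithTop ℝ)) _ _
      (by rw [(initMemory_spec G cost s M₀ e).1, if_pos he]) fun M _ _ hM =>
        bfRound_induction G h hw (inv := fun M => M.D e ≤ (cost e : WithTop ℝ))
          (fun M M' hM hM' => (hM'.le e).trans hM) hM
  induction p generalizing l e with
  | zero =>
    obtain rfl := List.length_eq_zero_iff.1 (Nat.le_zero.1 hp)
    simpa [PlaneDigraph.walkCost] using single 0 e (PlaneDigraph.isWalk_singleton.1 hl).1
  | succ p ih =>
    rcases List.eq_nil_or_concat l with rfl | ⟨l, f, rfl⟩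
    · simpa [PlaneDigraph.walkCost] using single (p + 1) e (PlaneDigraph.isWalk_singleton.1 hl).1
    · rw [List.concat_eq_append] at hl hp ⊢
      obtain ⟨h1, h2, -⟩ := PlaneDigraph.isWalk_snoc.1 hl
      have h3 := ih l f h1 (by simpa using hp)
      rw [rounds_succ_ret, PlaneDigraph.walkCost_snoc]
      refine (bfRound_D_le G h hw _ h2).trans ?_
      push_cast
      exact add_le_add_left (add_le_add_left h3 _) _

theorem rounds_induction (h : IsStepFunction c θ γ) {w : ℂ} (hw : w ≠ 0)
    {inv : Memory E → Prop} (hinv : ∀ M M', inv M → M.Improves G cost c M' → inv M') (p : ℕ)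
    {M : Memory E} (hM : inv M) : inv (rounds G w cost θ γ p M).ret :=
  foldlM_ret_induction _ inv _ _ hM fun _ _ _ hM => bfRound_induction G h hw hinv hM

theorem attained_init (s : V) (M₀ : Memory E) :
    (initMemory G cost s M₀).ret.Attained G cost c s := by
  intro e x hx
  rw [(initMemory_spec G cost s M₀ e).1] at hx
  split_ifs at hx with he
  · rw [← WithTop.coe_injective hx]
    exact .start he
  · exact absurd hx WithTop.top_ne_coe

theorem consistent_init (s : V) (M₀ : Memory E) :
    (initMemory G cost s M₀).ret.Consistent G cost c s := by
  intro e x hx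
  rw [(initMemory_spec G cost s M₀ e).1] at hx
  split_ifs at hx with he
  swap; · exact absurd hx WithTop.top_ne_coe
  exact Or.inl ⟨(initMemory_spec G cost s M₀ e).2.1, he, (WithTop.coe_injective hx).symm⟩

theorem acyclic_init (s t : V) (M₀ : Memory E) :
    (initMemory G cost s M₀).ret.Acyclic G cost c t := fun e _ _ _ =>
  ⟨_, fun a ha => by simp [(initMemory_spec G cost s M₀ e).2.1] at ha⟩

end Rounds

/-! ### The returned walk -/

section Trace

variable {V E : Type} (G : PlaneDigraph V E) {cost : E → ℝ} {c : ℝ → ℝ}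

theorem bestEdge_spec (D : E → WithTop ℝ) (l : List E) :
    ((bestEdge D l).ret = none → ∀ e ∈ l, D e = ⊤) ∧
      ∀ e, (bestEdge D l).ret = some e → e ∈ l ∧ D e < ⊤ ∧ ∀ f ∈ l, D e ≤ D f := by
  induction l using List.reverseRecOn with
  | nil => simp [bestEdge]
  | append_singleton l e ih =>
    rw [bestEdge, List.foldlM_append, ret_bind]
    rw [bestEdge] at ih
    generalize (l.foldlM _ _ : TimeM (Option E)).ret = b at ih
    simp only [List.foldlM_cons, List.foldlM_nil, ret_bind, ret_pure]
    cases b with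
    | none =>
      have ih := ih.1 rfl
      simp only [ret_pure]
      split_ifs with he
      · refine ⟨by simp, fun f hf => ?_⟩
        obtain rfl := Option.some.inj hf
        refine ⟨by simp, he, fun g hg => ?_⟩
        rcases List.mem_append.1 hg with hg | hg
        · rw [ih g hg]; exact le_top
        · rw [List.mem_singleton.1 hg]
      · refine ⟨fun _ g hg => ?_, by simp⟩
        rcases List.mem_append.1 hg with hg | hg
        · exact ih g hg
        · rw [List.mem_singleton.1 hg]; exact not_lt_top_iff.1 he
    | some f =>
      obtain ⟨h1, h2, h3⟩ := ih.2 f rfl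
      simp only [ret_pure]
      split_ifs with he
      · refine ⟨by simp, fun f' hf => ?_⟩
        obtain rfl := Option.some.inj hf
        refine ⟨by simp, he.trans h2, fun g hg => ?_⟩
        rcases List.mem_append.1 hg with hg | hg
        · exact he.le.trans (h3 g hg)
        · rw [List.mem_singleton.1 hg]
      · refine ⟨by simp, fun f' hf => ?_⟩
        obtain rfl := Option.some.inj hf
        refine ⟨by simp [h1], h2, fun g hg => ?_⟩
        rcases List.mem_append.1 hg with hg | hg
        · exact h3 g hg
        · rw [List.mem_singleton.1 hg]; exact not_lt.1 he

theorem not_rel_self_of_acc {α : Type*} {r : α → α → Prop} {a : α} (h : Acc r a) : ¬ r a a := by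
  induction h with
  | intro a _ ih => exact fun haa => ih a haa haa

/-- Following the predecessors from an edge gives a walk whose cost is at most the distance of the
edge. It visits no edge twice, so that the number of edges is enough fuel. -/
theorem trace_spec {s : V} {M : Memory E} (hC : M.Consistent G cost c s) {e : E}
    (hacc : Acc (fun a b => M.P b = some a) e) {x : ℝ} (hx : M.D e = x) (acc : List E) :
    ∃ l, (trace M.P G.edges e acc).ret = l ++ e :: acc ∧ G.IsWalk s (G.tgt e) (l ++ [e]) ∧
      G.walkCost cost c (l ++ [e]) ≤ x := by
  suffices key : ∀ x : ℝ, M.D e = x → ∃ l, G.IsWalk s (G.tgt e) (l ++ [e]) ∧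
      G.walkCost cost c (l ++ [e]) ≤ x ∧ (l ++ [e]).Nodup ∧
      (∀ h ∈ l, Relation.TransGen (fun a b => M.P b = some a) h e) ∧
      ∀ fuel acc : List E, l.length + 1 ≤ fuel.length →
        (trace M.P fuel e acc).ret = l ++ e :: acc by
    obtain ⟨l, h1, h2, h3, -, h5⟩ := key x hx
    have hlen := (List.subperm_of_subset h3 fun e _ => G.mem_edges e).length_le
    exact ⟨l, h5 _ _ (by simpa using hlen), h1, h2⟩
  clear hx x acc
  induction hacc with
  | intro e hpred ih =>
    intro x hx
    rcases hC e x hx with ⟨h1, h2, h3⟩ | ⟨f, y, h1, h2, h3, h4⟩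
    · refine ⟨[], PlaneDigraph.isWalk_singleton.2 ⟨h2, rfl⟩, by simp [PlaneDigraph.walkCost, h3],
        by simp, by simp, fun fuel acc hfuel => ?_⟩
      cases fuel with
      | nil => simp at hfuel
      | cons a fuel => simp [trace, h1]
    · obtain ⟨l, i1, i2, i3, i4, i5⟩ := ih f h1 y h3
      have htrans : ∀ h ∈ l ++ [f], Relation.TransGen (fun a b => M.P b = some a) h e := by
        intro h hh
        rcases List.mem_append.1 hh with hh | hh
        · exact (i4 h hh).tail h1
        · rw [List.mem_singleton.1 hh]; exact .single h1
      refine ⟨l ++ [f], PlaneDigraph.isWalk_snoc.2 ⟨i1, h2, rfl⟩, ?_, ?_, htrans, ?_⟩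
      · rw [PlaneDigraph.walkCost_snoc]; linarith
      · refine List.Nodup.append i3 (by simp) ?_
        rw [List.disjoint_singleton]
        exact fun he => not_rel_self_of_acc (Acc.transGen ⟨e, hpred⟩) (htrans e he)
      · intro fuel acc hfuel
        cases fuel with
        | nil => simp at hfuel
        | cons a fuel =>
          have := i5 fuel (e :: acc) (by simpa using hfuel)
          simp [trace, h1, this]

end Trace

section Correctness

variable {V E : Type} [DecidableEq E] (G : PlaneDigraph V E) {n : ℕ} {c : ℝ → ℝ}
  {θ : Fin n → ℝ} {γ : Fin (n + 1) → ℝ} {cost : E → ℝ}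

/-- The result and the time of the algorithm in terms of its phases. -/
theorem minAngleBellmanFord_eq (w : ℂ) (p : ℕ) (s t : V) (M₀ : Memory E) :
    let M₁ := initMemory G cost s M₀
    let M := rounds G w cost θ γ p M₁.ret
    let b := bestEdge M.ret.D (G.ins t)
    (minAngleBellmanFord G w cost θ γ p s t M₀).ret =
      b.ret.map (fun e => (trace M.ret.P G.edges e []).ret) ∧
    (minAngleBellmanFord G w cost θ γ p s t M₀).time =
      1 + (M₁.time + (M.time + (b.time + b.ret.elim 0 fun e =>
        (trace M.ret.P G.edges e []).time))) := by
  intro M₁ M b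
  have hb : bestEdge M.ret.D (G.ins t) = b := rfl
  have hM : (List.range p).foldlM (fun M _ => do
    tick
    bfRound G w cost θ γ M) M₁.ret = M := rfl
  have hM₁ : initMemory G cost s M₀ = M₁ := rfl
  simp only [minAngleBellmanFord, ret_bind, time_bind, time_tick, hM₁, hM, hb]
  cases b.ret <;> simp

theorem minAngleBellmanFord_ret_of_walk (h : IsStepFunction c θ γ) {w : ℂ} (hw : w ≠ 0) (p : ℕ)
    (s t : V) (M₀ : Memory E)
    (hwalk : ∃ l, G.IsShortestWalk cost c s t l ∧ l.length ≤ p + 1) :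
    ∃ l, (minAngleBellmanFord G w cost θ γ p s t M₀).ret = some l ∧
      G.IsShortestWalk cost c s t l := by
  obtain ⟨l, ⟨hl, hmin⟩, hlen⟩ := hwalk
  obtain ⟨l, e, rfl, rfl⟩ := hl.exists_eq_append
  have hle := rounds_D_le G (cost := cost) h hw s M₀ p l e hl (by simpa using hlen)
  obtain ⟨hA, hC, hP⟩ := rounds_induction G h hw (M := (initMemory G cost s M₀).ret)
    (inv := fun M => M.Attained G cost c s ∧ M.Consistent G cost c s ∧
      M.Acyclic G cost c (G.tgt e))
    (fun M M' ⟨h1, h2, h3⟩ hM' =>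
      ⟨h1.improves hM', h2.improves hM', h3.improves h2 h1 hmin hM'⟩) p
    ⟨attained_init G s M₀, consistent_init G s M₀, acyclic_init G s _ M₀⟩
  rw [(minAngleBellmanFord_eq G w p s (G.tgt e) M₀).1]
  generalize (rounds G w cost θ γ p (initMemory G cost s M₀).ret).ret = M at *
  obtain ⟨b1, b2⟩ := bestEdge_spec M.D (G.ins (G.tgt e))
  have he : e ∈ G.ins (G.tgt e) := (G.mem_ins _ e).2 rfl
  cases hb : (bestEdge M.D (G.ins (G.tgt e))).ret with
  | none =>
    rw [b1 hb e he] at hle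
    exact absurd hle (by simp)
  | some f =>
    obtain ⟨f1, f2, f3⟩ := b2 f hb
    have hft := (G.mem_ins _ f).1 f1
    obtain ⟨x, hx⟩ := WithTop.ne_top_iff_exists.1 f2.ne
    obtain ⟨l', t1, t2, t3⟩ := trace_spec G hC (hP f x hx.symm ⟨f, 0, hft, .refl⟩) hx.symm []
    refine ⟨l' ++ [f], by simp [t1], hft ▸ t2, fun w' hw' => ?_⟩
    have hxe := (f3 e he).trans hle
    rw [← hx, WithTop.coe_le_coe] at hxe
    exact (t3.trans hxe).trans (hmin w' hw')

theorem minAngleBellmanFord_ret_of_not_walk (h : IsStepFunction c θ γ) {w : ℂ} (hw : w ≠ 0)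
    (p : ℕ) (s t : V) (M₀ : Memory E) (hwalk : ¬ ∃ l, G.IsWalk s t l) :
    (minAngleBellmanFord G w cost θ γ p s t M₀).ret = none := by
  have hA := rounds_induction G h hw (M := (initMemory G cost s M₀).ret)
    (inv := fun M => M.Attained G cost c s) (fun M M' hM hM' => hM.improves hM') p
    (attained_init G s M₀)
  rw [(minAngleBellmanFord_eq G w p s t M₀).1, Option.map_eq_none_iff,
    Option.eq_none_iff_forall_ne_some]
  intro f hf
  obtain ⟨f1, f2, -⟩ := (bestEdge_spec _ _).2 f hf
  obtain ⟨x, hx⟩ := WithTop.ne_top_iff_exists.1 f2.ne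
  obtain ⟨l, hl, -⟩ := (hA f x hx.symm).exists_walk
  exact hwalk ⟨l, (G.mem_ins _ f).1 f1 ▸ hl⟩

end Correctness

/-! ### Running time of the whole algorithm -/

section Time

variable {V E : Type} (G : PlaneDigraph V E) {n : ℕ} {c : ℝ → ℝ}
  {θ : Fin n → ℝ} {γ : Fin (n + 1) → ℝ} {cost : E → ℝ}

/-- The bound for the update rule at `v`, up to a constant factor, with a binary logarithm rounded
down in place of the natural one. -/
def vertexBound (n : ℕ) (v : V) : ℕ :=
  (n * G.inDeg v + G.outDeg v + 1) * Nat.log 2 (n * G.inDeg v * G.outDeg v + 2)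

theorem add_le_vertexBound (hn : 1 ≤ n) (v : V) :
    G.inDeg v + G.outDeg v + 1 ≤ vertexBound G n v := by
  have hlog : 1 ≤ Nat.log 2 (n * G.inDeg v * G.outDeg v + 2) :=
    Nat.log_pos (by norm_num) (by omega)
  have hk : G.inDeg v ≤ n * G.inDeg v := Nat.le_mul_of_pos_left _ hn
  calc G.inDeg v + G.outDeg v + 1 ≤ (n * G.inDeg v + G.outDeg v + 1) * 1 := by omega
    _ ≤ _ := Nat.mul_le_mul_left _ hlog

theorem relax_time [DecidableEq E] (A : List (Assignment E)) (M : Memory E) :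
    (relax cost A M).time ≤ A.length := by
  have := foldlM_time_le (fun (M : Memory E) (a : Assignment E) => (do
    tick
    if a.value + (cost a.out : WithTop ℝ) < M.D a.out then
      pure (M.write a.out (a.value + (cost a.out : WithTop ℝ)) (some a.pred))
    else
      pure M : TimeM (Memory E))) (fun _ => True) 1 A M trivial (fun M a _ _ => ⟨trivial, by
        rw [time_bind]; split_ifs <;> simp⟩)
  simpa [relax] using this

theorem bestEdge_time (D : E → WithTop ℝ) (l : List E) : (bestEdge D l).time ≤ l.length := by
  unfold bestEdge
  refine (foldlM_time_le _ (fun _ => True) 1 l none trivial fun b e _ _ => ⟨trivial, ?_⟩).trans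
    (Nat.mul_one _).le
  rw [time_bind]
  cases b <;> simp

theorem trace_time (P : E → Option E) (fuel : List E) (e : E) (acc : List E) :
    (trace P fuel e acc).time ≤ fuel.length + 1 := by
  induction fuel generalizing e acc with
  | nil => simp [trace]
  | cons a fuel ih =>
    simp only [trace, time_bind, time_tick, List.length_cons]
    cases P e with
    | none => simp
    | some f => have := ih f (e :: acc); dsimp only; omega

theorem bfRound_time [DecidableEq E] (h : IsStepFunction c θ γ) {w : ℂ} (hw : w ≠ 0)
    (M : Memory E) :
    (bfRound G w cost θ γ M).time ≤ 44 * (G.verts.map (vertexBound G n)).sum := by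
  have := (foldlM_amortized (fun (M : Memory E) v => (do
    tick
    let A ← stepUpdate (G.direction w) θ γ (G.ins v) (G.outs v) M.D
    relax cost A M : TimeM (Memory E))) (fun _ => True) (fun _ => 0)
    (fun v => 44 * vertexBound G n v) G.verts M trivial (fun M v _ _ => ⟨trivial, by
      obtain ⟨h1, h2⟩ := stepUpdate_spec G h hw v M.D
      have h3 := (relax_time (cost := cost) _ M).trans (length_le_outDeg G h1)
      have h4 := add_le_vertexBound G h.pos v
      rw [← vertexBound] at h2
      simp only [time_bind, time_tick]
      omega⟩)).2
  rw [List.sum_map_mul_left] at this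
  simpa [bfRound] using this

theorem sum_verts [Fintype V] (f : V → ℕ) : (G.verts.map f).sum = ∑ v, f v := by
  classical
  rw [← List.sum_toFinset f G.verts_nodup]
  exact Finset.sum_congr (Finset.eq_univ_of_forall fun v => by simp [G.mem_verts]) fun _ _ => rfl

theorem length_edges_le [Fintype V] : G.edges.length ≤ ∑ v, G.outDeg v := by
  have := (List.subperm_of_subset (l₂ := G.verts.flatMap G.outs) G.edges_nodup fun e _ =>
    List.mem_flatMap.2 ⟨G.src e, G.mem_verts _, (G.mem_outs _ e).2 rfl⟩).length_le
  rwa [List.length_flatMap, sum_verts] at this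

theorem minAngleBellmanFord_time [Fintype V] [DecidableEq E] (h : IsStepFunction c θ γ)
    {w : ℂ} (hw : w ≠ 0) {p : ℕ} (hp : 1 ≤ p) (s t : V) (M₀ : Memory E) :
    (minAngleBellmanFord G w cost θ γ p s t M₀).time ≤ 50 * (p * ∑ v, vertexBound G n v) := by
  rw [(minAngleBellmanFord_eq G w p s t M₀).2]
  set S := ∑ v, vertexBound G n v with hS
  have hv : ∀ v, G.inDeg v + G.outDeg v + 1 ≤ S := fun v =>
    (add_le_vertexBound G h.pos v).trans
      (Finset.single_le_sum (fun _ _ => Nat.zero_le _) (Finset.mem_univ v))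
  have hE : G.edges.length + 1 ≤ S := by
    have h1 : ∑ v, (G.outDeg v + 1) ≤ S :=
      Finset.sum_le_sum fun v _ => (by omega : _ ≤ G.inDeg v + G.outDeg v + 1).trans
        (add_le_vertexBound G h.pos v)
    rw [Finset.sum_add_distrib] at h1
    have h2 : 1 ≤ ∑ _v : V, 1 :=
      Finset.single_le_sum (f := fun _ : V => 1) (fun _ _ => Nat.zero_le _) (Finset.mem_univ s)
    have := length_edges_le G
    omega
  have hinit : (initMemory G cost s M₀).time ≤ 2 * S := by
    have h1 := hv s
    -- `initMemory_spec` speaks of the time only in the presence of an edge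
    by_cases hne : Nonempty E
    · obtain ⟨e⟩ := hne
      rw [(initMemory_spec G cost s M₀ e).2.2]
      omega
    · have e1 : G.edges = [] := List.eq_nil_iff_forall_not_mem.2 fun e => (hne ⟨e⟩).elim
      have e2 : G.outs s = [] := List.eq_nil_iff_forall_not_mem.2 fun e => (hne ⟨e⟩).elim
      simp [initMemory, e1, e2]
  have hrounds : ∀ M, (rounds G w cost θ γ p M).time ≤ p * (45 * S) := fun M => by
    have := foldlM_time_le (fun (M : Memory E) (_ : ℕ) => (do
      tick
      bfRound G w cost θ γ M : TimeM (Memory E))) (fun _ => True) (45 * S) (List.range p) M trivial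
      (fun M _ _ _ => ⟨trivial, by
        have := bfRound_time G (cost := cost) h hw M
        rw [sum_verts, ← hS] at this
        simp only [time_bind, time_tick]
        omega⟩)
    simpa [rounds] using this
  have hS' : S ≤ p * S := Nat.le_mul_of_pos_left _ hp
  have hround := hrounds (initMemory G cost s M₀).ret
  generalize rounds G w cost θ γ p (initMemory G cost s M₀).ret = M at *
  have hbest : (bestEdge M.ret.D (G.ins t)).time ≤ G.inDeg t := bestEdge_time _ _
  have htrace : ((bestEdge M.ret.D (G.ins t)).ret.elim 0 fun e =>
      (trace M.ret.P G.edges e []).time) ≤ S := by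
    cases (bestEdge M.ret.D (G.ins t)).ret with
    | none => exact Nat.zero_le _
    | some e => exact (trace_time _ _ _ _).trans hE
  have := hv t
  rw [Nat.mul_left_comm] at hround
  omega

/-! ### From binary to natural logarithms -/

theorem vertexBound_le (v : V) :
    (vertexBound G n v : ℝ) ≤ 2 * ((n * G.inDeg v + G.outDeg v + 1 : ℝ) *
      Real.log (n * G.inDeg v * G.outDeg v + 2 : ℝ)) := by
  have h1 := Real.natLog_le_logb (n * G.inDeg v * G.outDeg v + 2) 2
  rw [Real.logb, le_div_iff₀ (Real.log_pos (by norm_num))] at h1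
  push_cast at h1
  have h2 : (Nat.log 2 (n * G.inDeg v * G.outDeg v + 2) : ℝ) ≤
      2 * Real.log (n * G.inDeg v * G.outDeg v + 2 : ℝ) := by
    have := Real.log_two_gt_d9
    have h0 : (0 : ℝ) ≤ Nat.log 2 (n * G.inDeg v * G.outDeg v + 2) := Nat.cast_nonneg _
    nlinarith
  rw [vertexBound]
  push_cast
  rw [mul_left_comm]
  exact mul_le_mul_of_nonneg_left h2 (by positivity)

theorem add_one_mul_log_le {a b : ℝ} (ha : 1 ≤ a) (hb : 2 ≤ b) :
    (a + 1) * Real.log (b + 2) ≤ 4 * (a * Real.log b) := by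
  have h0 : 0 ≤ Real.log b := Real.log_nonneg (by linarith)
  have h1 : Real.log (b + 2) ≤ 2 * Real.log b := by
    have : Real.log (b ^ 2) = 2 * Real.log b := by rw [Real.log_pow]; norm_num
    rw [← this]
    exact Real.log_le_log (by linarith) (by nlinarith)
  calc (a + 1) * Real.log (b + 2) ≤ (2 * a) * (2 * Real.log b) :=
        mul_le_mul (by linarith) h1 (Real.log_nonneg (by linarith)) (by linarith)
    _ = _ := by ring

theorem vertexBound_le_of_two_le {v : V} (hv : 2 ≤ n * G.inDeg v * G.outDeg v) :
    (vertexBound G n v : ℝ) ≤ 8 * ((n * G.inDeg v + G.outDeg v : ℝ) *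
      Real.log (n * G.inDeg v * G.outDeg v : ℝ)) := by
  have hl : 1 ≤ G.outDeg v := Nat.pos_of_ne_zero fun h => by simp [h] at hv
  have h1 : (1 : ℝ) ≤ n * G.inDeg v + G.outDeg v := by exact_mod_cast (by omega)
  have h2 : (2 : ℝ) ≤ n * G.inDeg v * G.outDeg v := by exact_mod_cast hv
  have := add_one_mul_log_le h1 h2
  linarith [vertexBound_le G (n := n) v]

end Time

end MinAngleBF

theorem mainTheorem1 :
    ∃ C : ℝ, 0 < C ∧
      ∀ (V E : Type) [Fintype V] [DecidableEq E] (G : MinAngleBF.PlaneDigraph V E)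
        (dir : ℂ), dir ≠ 0 → ∀ (cost : E → ℝ)
        (n : ℕ) (c : ℝ → ℝ) (θ : Fin n → ℝ) (γ : Fin (n + 1) → ℝ),
        MinAngleBF.IsStepFunction c θ γ →
        -- the update at one vertex: correctness and number of operations
        (∀ (v : V) (D : E → WithTop ℝ),
          MinAngleBF.IsOptimalAssignment G c v D
            (MinAngleBF.stepUpdate (G.direction dir) θ γ (G.ins v) (G.outs v) D).ret ∧
          ((MinAngleBF.stepUpdate (G.direction dir) θ γ (G.ins v) (G.outs v) D).time : ℝ) ≤
            C * ((n * G.inDeg v + G.outDeg v + 1 : ℝ) *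
              Real.log (n * G.inDeg v * G.outDeg v + 2 : ℝ)) ∧
          (2 ≤ n * G.inDeg v * G.outDeg v →
            ((MinAngleBF.stepUpdate (G.direction dir) θ γ (G.ins v) (G.outs v) D).time : ℝ) ≤
              C * ((n * G.inDeg v + G.outDeg v : ℝ) *
                Real.log (n * G.inDeg v * G.outDeg v : ℝ)))) ∧
        -- the whole algorithm
        (∀ (p : ℕ) (s t : V) (M₀ : MinAngleBF.Memory E),
          -- it computes a shortest walk
          ((∃ w, G.IsShortestWalk cost c s t w ∧ w.length ≤ p + 1) →
            ∃ w, (MinAngleBF.minAngleBellmanFord G dir cost θ γ p s t M₀).ret = some w ∧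
              G.IsShortestWalk cost c s t w) ∧
          ((¬ ∃ w, G.IsWalk s t w) →
            (MinAngleBF.minAngleBellmanFord G dir cost θ γ p s t M₀).ret = none) ∧
          -- number of operations
          (1 ≤ p →
            ((MinAngleBF.minAngleBellmanFord G dir cost θ γ p s t M₀).time : ℝ) ≤
              C * (p * ∑ v : V, (n * G.inDeg v + G.outDeg v + 1 : ℝ) *
                Real.log (n * G.inDeg v * G.outDeg v + 2 : ℝ))) ∧
          (1 ≤ p → (∀ v, 2 ≤ n * G.inDeg v * G.outDeg v) →
            ((MinAngleBF.minAngleBellmanFord G dir cost θ γ p s t M₀).time : ℝ) ≤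
              C * (p * ∑ v : V, (n * G.inDeg v + G.outDeg v : ℝ) *
                Real.log (n * G.inDeg v * G.outDeg v : ℝ)))) := by
  -- `400 = 50 * 8`, from `minAngleBellmanFord_time` and `vertexBound_le_of_two_le`
  refine ⟨400, by norm_num, ?_⟩
  intro V E _ _ G dir hdir cost n c θ γ h
  refine ⟨fun v D => ?_, fun p s t M₀ =>
    ⟨MinAngleBF.minAngleBellmanFord_ret_of_walk G h hdir p s t M₀,
      MinAngleBF.minAngleBellmanFord_ret_of_not_walk G h hdir p s t M₀, fun hp => ?_,
      fun hp hv => ?_⟩⟩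
  · obtain ⟨h1, h2⟩ := MinAngleBF.stepUpdate_spec G h hdir v D
    rw [← MinAngleBF.vertexBound] at h2
    have h3 : ((MinAngleBF.stepUpdate (G.direction dir) θ γ (G.ins v) (G.outs v) D).time : ℝ) ≤
        43 * MinAngleBF.vertexBound G n v := by exact_mod_cast h2
    have h0 : (0 : ℝ) ≤ MinAngleBF.vertexBound G n v := Nat.cast_nonneg _
    refine ⟨h1, ?_, fun hv => ?_⟩
    · linarith [MinAngleBF.vertexBound_le G (n := n) v]
    · linarith [MinAngleBF.vertexBound_le_of_two_le G hv]
  all_goals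
    have h1 : ((MinAngleBF.minAngleBellmanFord G dir cost θ γ p s t M₀).time : ℝ) ≤
        50 * (p * ∑ v, (MinAngleBF.vertexBound G n v : ℝ)) := by
      exact_mod_cast MinAngleBF.minAngleBellmanFord_time G h hdir hp s t M₀
    have h0 : (0 : ℝ) ≤ ∑ v, (MinAngleBF.vertexBound G n v : ℝ) :=
      Finset.sum_nonneg fun _ _ => Nat.cast_nonneg _
    have hp0 : (0 : ℝ) ≤ p := Nat.cast_nonneg p
  · have h2 := Finset.sum_le_sum fun v (_ : v ∈ Finset.univ) =>
      MinAngleBF.vertexBound_le G (n := n) v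
    rw [← Finset.mul_sum] at h2
    nlinarith [mul_le_mul_of_nonneg_left h2 hp0, mul_nonneg hp0 h0]
  · have h2 := Finset.sum_le_sum fun v (_ : v ∈ Finset.univ) =>
      MinAngleBF.vertexBound_le_of_two_le G (hv v)
    rw [← Finset.mul_sum] at h2
    nlinarith [mul_le_mul_of_nonneg_left h2 hp0, mul_nonneg hp0 h0]
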